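/- Let $R$ be a generalized Cohen–Kaplansky domain, i.e. an integral domain in which every nonzero nonunit is a finite product of atoms and in which, up to associates, only finitely many atoms are not prime elements. Let $K$ be the quotient field of $R$, and for $A,B\subset K$ put $(A:B)=\{x\in K\mid xB\subset A\}$. Let $\widehat R=\{x\in K\mid \text{there is } c\in R\setminus\{0\} \text{ with } cx^n\in R \text{ for all } n\ge 1\}$ be the complete integral closure of $R$, and let $\mathfrak X(R)$ be the set of minimal nonzero prime ideals of $R$. Let $r$ be an ideal system on $R$, i.e. a map $X\mapsto X_r$ from the subsets of $R$ to the subsets of $R$ such that $X\cup\{0\}\subset X_r$, such that $X\subset Y_r$ implies $X_r\subset Y_r$, and such that $cR\subset\{c\}_r$ and $cX_r=(cX)_r$, for all $X,Y\subset R$ and $c\in R$; assume, moreover, that every $r$-ideal (a set $I$ with $I_r=I$) is an ideal of the ring $R$. Let $\mathcal I_r(R)$ be the commutative semigroup of nonzero $r$-ideals with multiplication $I\cdot_r J=(IJ)_r$ and identity $R$, let $\mathcal A(\mathcal I_r(R))$ be its set of atoms (non-invertible $I$ such that $I=J\cdot_r L$ implies that $J$ or $L$ is invertible), and let $r\text{-}\max(R)$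 be the set of maximal elements of $\mathcal I_r(R)\setminus\{R\}$. Call $r$ finitary if $X_r=\bigcup\{E_r\mid E\subset X \text{ finite}\}$ for all $X\subset R$. The $v$-system is given by $X_v=(R:(R:X))$ if $X$ contains a nonzero element, and $X_v=\{0\}$ otherwise. Call $R$ a G-domain if the intersection of all nonzero prime ideals of $R$ is nonzero (the empty intersection being $R$). Put $\mathcal P=\{\mathfrak p\in\mathfrak X(R)\mid \mathfrak p\not\supset (R:\widehat R)\}$ and $\mathcal P^*=\mathfrak X(R)\setminus\mathcal P$, and let $T$ be the subsemigroup (with identity $R$) of $\mathcal I_r(R)$ generated by $\{I\in\mathcal A(\mathcal I_r(R))\mid \sqrt I\in\mathcal P^*\}$. Suppose that one of the following conditions holds: (a) $r$ is finitary and $r\text{-}\max(R)=\mathfrak X(R)$; (b) $r=v$; (c) $R$ is a G-domain. Then $R$ is $r$-Noetherian (every ascending chain of $r$-ideals becomes stationary), the set $\{I\in\mathcal A(\mathcal I_r(R))\mid \sqrt I\in\mathcal P^*\}$ is finite, $T$ is a finitely generated monoid (in particular unit-cancellative: $AU=A$ with $A,U\in T$ implies that $U$ is invertible in $T$), and $\mathcal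 I_r(R)\cong\mathcal F(\mathcal P)\times T$ as semigroups with identity, where $\mathcal F(\mathcal P)$ is the free abelian monoid with basis $\mathcal P$. -/

import Mathlib

open scoped Pointwise

namespace RIdealTheory

/-! ### Colon sets in the quotient field, complete integral closure, conductor -/

section Colon

variable (R : Type*) [CommRing R]

/-- The domain `R`, viewed as a subset of its quotient field. -/
def base : Set (FractionRing R) := Set.range (algebraMap R (FractionRing R))

variable {R} in
/-- `(A : B) = {x ∈ K | x B ⊆ A}` for subsets `A`, `B` of the quotient field `K` of `R`. -/
def colon (A B : Set (FractionRing R)) : Set (FractionRing R) :=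
  {x | ∀ b ∈ B, x * b ∈ A}

variable {R} in
/-- `(R : B) ∩ R`, as an ideal of `R`. -/
def colonIdeal (B : Set (FractionRing R)) : Ideal R where
  carrier := {x | algebraMap R (FractionRing R) x ∈ colon (base R) B}
  zero_mem' := fun b _ => ⟨0, by simp⟩
  add_mem' := by
    intro x y hx hy b hb
    obtain ⟨u, hu⟩ := hx b hb
    obtain ⟨v, hv⟩ := hy b hb
    exact ⟨u + v, by rw [map_add, map_add, add_mul, hu, hv]⟩
  smul_mem' := by
    intro c x hx b hb
    obtain ⟨u, hu⟩ := hx b hb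
    exact ⟨c * u, by rw [smul_eq_mul, map_mul, map_mul, mul_assoc, hu]⟩

/-- The complete integral closure of `R`: all `x` in the quotient field for which there is a
nonzero `c ∈ R` with `c x ^ n ∈ R` for all `n ≥ 1`. -/
def completeIntegralClosure : Set (FractionRing R) :=
  {x | ∃ c : R, c ≠ 0 ∧ ∀ n : ℕ, 1 ≤ n → algebraMap R (FractionRing R) c * x ^ n ∈ base R}

/-- The conductor `(R : R^)`, where `R^` is the complete integral closure of `R`. As `1 ∈ R^`,
it is contained in `R`; it is an ideal of `R`. -/
def conductor : Ideal R := colonIdeal (completeIntegralClosure R)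

end Colon

/-! ### Classes of domains -/

section Domains

variable (R : Type*) [CommRing R]

/-- `R` is atomic: every nonzero nonunit is a finite product of atoms. -/
def IsAtomicDomain : Prop :=
  ∀ a : R, a ≠ 0 → ¬ IsUnit a → ∃ s : Multiset R, (∀ b ∈ s, Irreducible b) ∧ s.prod = a

/-- Generalized Cohen-Kaplansky domain: an atomic domain with, up to associates, only finitely
many atoms that are not prime elements. -/
def IsGeneralizedCohenKaplansky : Prop :=
  IsDomain R ∧ IsAtomicDomain R ∧
    {a : Associates R | ∃ b : R, Associates.mk b = a ∧ Irreducible b ∧ ¬ Prime b}.Finite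

/-- `R` is a G-domain: the intersection of all nonzero prime ideals is nonzero
(the empty intersection being `R`). -/
def IsGDomain : Prop :=
  IsDomain R ∧ ∃ a : R, a ≠ 0 ∧ ∀ p : Ideal R, p.IsPrime → p ≠ ⊥ → a ∈ p

/-- `𝔛(R)`: the set of minimal nonzero prime ideals. -/
def minNonzeroPrimes : Set (Ideal R) :=
  {p | Minimal (fun q : Ideal R => q.IsPrime ∧ q ≠ ⊥) p}

/-- The set `P` of all `p ∈ 𝔛(R)` not containing the conductor. -/
def primesNotAboveConductor : Set (Ideal R) :=
  {p ∈ minNonzeroPrimes R | ¬ conductor R ≤ p}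

/-- The set `P* = 𝔛(R) \ P`. -/
def primesAboveConductor : Set (Ideal R) :=
  minNonzeroPrimes R \ primesNotAboveConductor R

end Domains

/-- A commutative semigroup with identity is unit-cancellative if `a u = a` implies that `u` is
invertible. -/
def IsUnitCancellative (M : Type*) [CommMonoid M] : Prop :=
  ∀ a u : M, a * u = a → IsUnit u

/-! ### Ideal systems -/

/-- An ideal system `r : X ↦ X_r` on `R`, all of whose `r`-ideals are ring ideals: a map on subsets
with `X ⊆ X_r`, with `X_r ⊆ Y_r` whenever `X ⊆ Y_r`, with `c R ⊆ {c}_r` (automatic here as `X_r` is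
an ideal), and with `(c X)_r = c X_r`. Since each `X_r` is an `r`-ideal, requiring that all
`r`-ideals are ring ideals amounts to taking the values in `Ideal R`. -/
@[ext]
structure IdealSystem (R : Type*) [CommRing R] where
  /-- The map `X ↦ X_r`. -/
  cl : Set R → Ideal R
  subset_cl : ∀ X : Set R, X ⊆ cl X
  cl_le : ∀ X Y : Set R, X ⊆ cl Y → cl X ≤ cl Y
  cl_smul : ∀ (c : R) (X : Set R), (cl (c • X) : Set R) = c • (cl X : Set R)

namespace IdealSystem

section Basic

variable {R : Type*} [CommRing R] (r : IdealSystem R)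

/-- `I` is an `r`-ideal if `I_r = I`. -/
def IsRIdeal (I : Ideal R) : Prop := r.cl I = I

/-- `r` is finitary: `X_r` is the union of all `E_r` with `E ⊆ X` finite. -/
def IsFinitary : Prop :=
  ∀ (X : Set R) (x : R), x ∈ r.cl X ↔ ∃ E : Set R, E.Finite ∧ E ⊆ X ∧ x ∈ r.cl E

/-- `R` is `r`-Noetherian: ascending chains of `r`-ideals become stationary. -/
def IsNoetherian : Prop :=
  ∀ I : ℕ → Ideal R, Monotone I → (∀ n, r.IsRIdeal (I n)) → ∃ n, ∀ m, n ≤ m → I m = I n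

/-- `r-max(R)`: the set of maximal elements among the proper nonzero `r`-ideals. -/
def maxSpec : Set (Ideal R) :=
  {M | Maximal (fun I : Ideal R => r.IsRIdeal I ∧ I ≠ ⊥ ∧ I ≠ ⊤) M}

theorem isRIdeal_cl (X : Set R) : r.IsRIdeal (r.cl X) :=
  le_antisymm (r.cl_le _ _ subset_rfl) (r.subset_cl _)

theorem isRIdeal_top : r.IsRIdeal (⊤ : Ideal R) :=
  le_antisymm le_top (r.subset_cl _)

theorem le_cl (I : Ideal R) : I ≤ r.cl I := r.subset_cl _

theorem cl_le_cl {X Y : Set R} (h : X ⊆ Y) : r.cl X ≤ r.cl Y :=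
  r.cl_le _ _ (h.trans (r.subset_cl _))

/-- The closure of the set of products and that of the product ideal agree. -/
theorem cl_set_mul (I J : Ideal R) : r.cl ((I : Set R) * (J : Set R)) = r.cl (I * J : Ideal R) := by
  apply le_antisymm
  · apply r.cl_le_cl
    rintro _ ⟨a, ha, b, hb, rfl⟩
    exact Ideal.mul_mem_mul ha hb
  · apply r.cl_le
    show I * J ≤ _
    rw [Ideal.mul_le]
    intro a ha b hb
    exact r.subset_cl _ ⟨a, ha, b, hb, rfl⟩

theorem cl_cl_mul (I J : Ideal R) : r.cl (r.cl I * J : Ideal R) = r.cl (I * J : Ideal R) := by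
  apply le_antisymm
  · apply r.cl_le
    show r.cl I * J ≤ _
    rw [Ideal.mul_le]
    intro a ha b hb
    have h1 : b * a ∈ (r.cl (b • (I : Set R)) : Set R) := by
      rw [r.cl_smul]
      exact ⟨a, ha, rfl⟩
    have h2 : r.cl (b • (I : Set R)) ≤ r.cl (I * J : Ideal R) := by
      apply r.cl_le_cl
      rintro _ ⟨i, hi, rfl⟩
      show b * i ∈ I * J
      rw [mul_comm b i]
      exact Ideal.mul_mem_mul hi hb
    rw [mul_comm a b]
    exact h2 h1
  · apply r.cl_le_cl
    exact Ideal.mul_mono_left (r.le_cl I)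

end Basic

section Monoid

variable {R : Type*} [CommRing R]

/-- `I_r(R)`: the type of nonzero `r`-ideals. -/
def Ideals (r : IdealSystem R) : Type _ := {I : Ideal R // r.IsRIdeal I ∧ I ≠ ⊥}

variable [IsDomain R] {r : IdealSystem R}

/-- `I_r(R)` is a commutative semigroup with identity `R` under `r`-multiplication
`I ·_r J = (I J)_r`. -/
instance : CommMonoid r.Ideals where
  mul I J := ⟨r.cl ((I.1 : Set R) * (J.1 : Set R)), r.isRIdeal_cl _, by
    rw [r.cl_set_mul]
    exact ne_bot_of_le_ne_bot (mul_ne_zero I.2.2 J.2.2) (r.le_cl _)⟩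
  one := ⟨⊤, r.isRIdeal_top, top_ne_bot⟩
  mul_assoc I J L := Subtype.ext <| by
    show r.cl ((r.cl ((I.1 : Set R) * (J.1 : Set R)) : Set R) * (L.1 : Set R)) =
      r.cl ((I.1 : Set R) * (r.cl ((J.1 : Set R) * (L.1 : Set R)) : Set R))
    simp only [r.cl_set_mul]
    rw [r.cl_cl_mul, mul_comm I.1 (r.cl _), r.cl_cl_mul, mul_assoc, mul_comm I.1]
  mul_comm I J := Subtype.ext <| by
    show r.cl ((I.1 : Set R) * (J.1 : Set R)) = r.cl ((J.1 : Set R) * (I.1 : Set R))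
    rw [mul_comm]
  one_mul I := Subtype.ext <| by
    show r.cl (((⊤ : Ideal R) : Set R) * (I.1 : Set R)) = I.1
    rw [r.cl_set_mul, Ideal.top_mul]
    exact I.2.1
  mul_one I := Subtype.ext <| by
    show r.cl ((I.1 : Set R) * ((⊤ : Ideal R) : Set R)) = I.1
    rw [r.cl_set_mul, Ideal.mul_top]
    exact I.2.1

variable (r)

/-- The set of all atoms `I` of `I_r(R)` whose radical belongs to `P*`. -/
def atomsAboveConductor : Set r.Ideals :=
  {I | Irreducible I ∧ I.1.radical ∈ primesAboveConductor R}

/-- The subsemigroup `T` (with identity `R`) of `I_r(R)` generated by the atoms whose radical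
belongs to `P*`. -/
def conductorPart : Submonoid r.Ideals := Submonoid.closure r.atomsAboveConductor

end Monoid

section VSystem

variable (R : Type*) [CommRing R] [IsDomain R]

open Classical in
/-- The `v`-system: `X_v = (X⁻¹)⁻¹` with `A⁻¹ = (R : A)` if `X` contains a nonzero element (this is
a subset of `R` because `1 ∈ X⁻¹`), and `X_v = {0}` otherwise. -/
noncomputable def v : IdealSystem R where
  cl X := if X ⊆ {0} then ⊥ else colonIdeal (colon (base R) (algebraMap R (FractionRing R) '' X))
  subset_cl X := by
    split_ifs with h
    · simpa using h
    · intro x hx y hy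
      rw [mul_comm]
      exact hy _ ⟨x, hx, rfl⟩
  cl_le X Y h := by
    by_cases hX : X ⊆ {0}
    · simp [hX]
    · have hY : ¬ Y ⊆ {0} := by
        intro hY
        rw [if_pos hY] at h
        exact hX (by simpa using h)
      rw [if_neg hY] at h
      rw [if_neg hX, if_neg hY]
      intro x hx y hy
      apply hx
      rintro _ ⟨a, ha, rfl⟩
      rw [mul_comm]
      exact h ha y hy
  cl_smul c X := by
    by_cases hc : c = 0
    · subst hc
      have h0 : (0 : R) • X ⊆ {0} := by
        rintro _ ⟨x, -, rfl⟩
        simp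
      rw [if_pos h0]
      ext x
      constructor
      · intro hx
        exact ⟨0, Submodule.zero_mem _, by simpa using (show x = 0 from hx).symm⟩
      · rintro ⟨y, -, rfl⟩
        simp
    · have hc' : algebraMap R (FractionRing R) c ≠ 0 := by
        simpa using hc
      have hiff : c • X ⊆ {0} ↔ X ⊆ {0} := by
        constructor
        · intro h x hx
          have := h (Set.smul_mem_smul_set (a := c) hx)
          simpa [hc] using this
        · rintro h _ ⟨x, hx, rfl⟩
          have := h hx
          simp_all
      by_cases hX : X ⊆ {0}
      · rw [if_pos hX, if_pos (hiff.2 hX)]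
        ext x
        simp
      · rw [if_neg hX, if_neg (fun h => hX (hiff.1 h))]
        ext x
        constructor
        · intro hx
          have key : ∀ z ∈ colon (base R) (algebraMap R (FractionRing R) '' X),
              algebraMap R (FractionRing R) x * ((algebraMap R (FractionRing R) c)⁻¹ * z) ∈
                base R := by
            intro z hz
            apply hx
            rintro _ ⟨_, ⟨a, ha, rfl⟩, rfl⟩
            have := hz _ ⟨a, ha, rfl⟩
            simp only [smul_eq_mul, map_mul]
            convert this using 1
            field_simp
          obtain ⟨x', hx'⟩ := key 1 (by rintro _ ⟨a, ha, rfl⟩; exact ⟨a, by simp⟩)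
          have hxx : algebraMap R (FractionRing R) x =
              algebraMap R (FractionRing R) c * algebraMap R (FractionRing R) x' := by
            rw [hx']
            field_simp
          refine ⟨x', ?_, ?_⟩
          · intro z hz
            have := key z hz
            rw [hxx] at this
            convert this using 1
            field_simp
          · apply IsFractionRing.injective R (FractionRing R)
            simp [hxx]
        · rintro ⟨x', hx', rfl⟩ y hy
          have := hx' (algebraMap R (FractionRing R) c * y) (by
            rintro _ ⟨a, ha, rfl⟩
            have := hy _ ⟨c * a, ⟨a, ha, rfl⟩, rfl⟩
            rw [map_mul] at this
            convert this using 1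
            ring)
          simp only [smul_eq_mul, map_mul]
          convert this using 1
          ring

end VSystem

end IdealSystem

end RIdealTheory

/-!
Call an element or an ideal of `R` *prime-free* if no prime element divides it. Every nonzero element
is a product of prime elements times a prime-free element, and the prime-free elements form a
divisor-closed monoid `H` that is generated by the units and finitely many atoms. Similarly every
nonzero ideal is a product of prime elements times a prime-free ideal. The theorem says that `T` is
the monoid of prime-free `r`-ideals, and that this monoid is small.

*The primes.* There are only finitely many prime ideals without prime elements, and they have height
one (`IsAtomicDomain.eq_of_le_of_finite_atoms`). So each such prime `i` contains a prime-free element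
`c i` that lies in no other one. The key fact about `H` is that every element of `H` has a power
that is associated to a product of powers of the `c i`
(`IsGeneralizedCohenKaplansky.isPrimeFree_mem_rootSubmonoid`). As `H` is finitely generated, every
element of `H` is then a monomial in the `c i` times one of finitely many remainders
(`SeparatingSystem`). Comparing exponents, a monomial lies in the conductor, so ideals generated by
prime elements do not contain the conductor. The primes without prime elements contain it, since
otherwise they would be principal (`IsGeneralizedCohenKaplansky.conductor_le`). Thus the prime ideals
in `P` are those generated by prime elements, and those in `P*` are the ones without prime elements.

*The ideals.* Each of the three conditions on `r` implies that a proper `r`-ideal containing a prime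
element `s` equals `sR` (`IdealSystem.PrimeElementsMaximal`). Nothing else about `r` is needed.
It follows that prime elements can be cancelled in prime-free `r`-ideals, which are therefore
determined by their intersection with `H`, so that Dickson's lemma gives the ascending chain
condition. A prime-free `r`-ideal is the `r`-product of its components at the primes without prime
elements; hence the radical of a prime-free atom is such a prime `i`, and the atom either equals
`c i R` or contains a bounded power of `c i`. In the second case it is determined by finitely many
elements of bounded exponent, so there are only finitely many atoms
(`IdealSystem.finite_irreducible_primeFreePart`). Finally `I * J = I` with `J ≠ R` prime-free would
put `I` into all ideals `(c i) ^ k R`, so the prime-free part is unit-cancellative and generated by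
its atoms.
-/

namespace RIdealTheory

/-! ### Prime-free elements and prime-saturated ideals -/

section Basic

variable {R : Type*} [CommRing R]

/-- A nonzero element is prime-free if no prime element divides it. Such elements form a
divisor-closed monoid; in an atomic domain it is generated by the units and the atoms that are not prime. -/
def IsPrimeFree (h : R) : Prop := h ≠ 0 ∧ ∀ s, Prime s → ¬ s ∣ h

theorem IsPrimeFree.of_dvd {x y : R} (hy : IsPrimeFree y) (h : x ∣ y) : IsPrimeFree x :=
  ⟨fun h0 => hy.1 (zero_dvd_iff.1 (h0 ▸ h)), fun s hs h' => hy.2 s hs (h'.trans h)⟩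

/-- An ideal is prime-saturated if prime elements can be cancelled in it: it is contracted from
the localization of `R` at the multiplicative set generated by the prime elements. -/
def IsPrimeSaturated (I : Ideal R) : Prop := ∀ s x, Prime s → s * x ∈ I → x ∈ I

theorem IsPrimeSaturated.mem_of_prod_mul_mem {I : Ideal R} (hI : IsPrimeSaturated I)
    {m : Multiset R} (hm : ∀ s ∈ m, Prime s) {x : R} (hx : m.prod * x ∈ I) : x ∈ I := by
  induction m using Multiset.induction with
  | empty => simpa using hx
  | cons a m ih =>
    rw [Multiset.prod_cons, mul_assoc] at hx
    exact ih (fun s hs => hm s (Multiset.mem_cons_of_mem hs))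
      (hI a _ (hm a (Multiset.mem_cons_self a m)) hx)

/-- The ideal quotient `(I : x)`. -/
def colonElem (I : Ideal R) (x : R) : Ideal R where
  carrier := {t | t * x ∈ I}
  zero_mem' := by simp
  add_mem' := fun ha hb => by
    simp only [Set.mem_ofPred_eq] at *
    rw [add_mul]
    exact add_mem ha hb
  smul_mem' := fun c x hx => by
    simp only [Set.mem_ofPred_eq, smul_eq_mul] at *
    rw [mul_assoc]
    exact Ideal.mul_mem_left _ _ hx

@[simp] theorem mem_colonElem {I : Ideal R} {x t : R} : t ∈ colonElem I x ↔ t * x ∈ I := Iff.rfl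

theorem le_colonElem (I : Ideal R) (x : R) : I ≤ colonElem I x :=
  fun _ ht => Ideal.mul_mem_right _ _ ht

theorem isPrimeSaturated_colonElem {I : Ideal R} (hI : IsPrimeSaturated I) (x : R) :
    IsPrimeSaturated (colonElem I x) := fun s y hs hy => by
  rw [mem_colonElem] at *
  exact hI s _ hs (by rwa [← mul_assoc])

end Basic

section Atomic

variable {R : Type*} [CommRing R] [IsDomain R]

theorem IsAtomicDomain.induction (hat : IsAtomicDomain R) {P : R → Prop}
    (unit : ∀ u, IsUnit u → P u)
    (mul : ∀ b x, Irreducible b → x ≠ 0 → P x → P (b * x)) (x : R) (hx : x ≠ 0) : P x := by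
  by_cases hu : IsUnit x
  · exact unit x hu
  obtain ⟨s, hs, rfl⟩ := hat x hx hu
  clear hu hx
  induction s using Multiset.induction with
  | empty => exact unit _ (by simp)
  | cons a s ih =>
    rw [Multiset.prod_cons]
    have hs' : ∀ b ∈ s, Irreducible b := fun b hb => hs b (Multiset.mem_cons_of_mem hb)
    exact mul a _ (hs a (Multiset.mem_cons_self a s))
      (Multiset.prod_ne_zero fun h0 => (hs' 0 h0).ne_zero rfl) (ih hs')

theorem IsAtomicDomain.exists_not_pow_dvd (hat : IsAtomicDomain R) {s : R} (hs : Prime s)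
    (c : R) (hc : c ≠ 0) : ∃ k : ℕ, ¬ s ^ k ∣ c := by
  refine hat.induction (P := fun c => ∃ k : ℕ, ¬ s ^ k ∣ c) ?_ ?_ c hc
  · exact fun u hu => ⟨1, fun h => hs.not_isUnit (isUnit_of_dvd_unit (by simpa using h) hu)⟩
  · rintro b x hb hx ⟨k, hk⟩
    refine ⟨k + 1, fun h => hk ?_⟩
    by_cases hsb : s ∣ b
    · obtain ⟨u, rfl⟩ := hsb
      have hu : IsUnit u := (hb.isUnit_or_isUnit rfl).resolve_left hs.not_isUnit
      rw [pow_succ', mul_assoc, mul_dvd_mul_iff_left hs.ne_zero] at h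
      exact (hu.dvd_mul_left).1 h
    · exact (pow_dvd_pow s k.le_succ).trans (hs.pow_dvd_of_dvd_mul_left _ hsb h)

theorem IsPrimeFree.mul {x y : R} (hx : IsPrimeFree x) (hy : IsPrimeFree y) :
    IsPrimeFree (x * y) :=
  ⟨mul_ne_zero hx.1 hy.1, fun s hs h => (hs.dvd_or_dvd h).elim (hx.2 s hs) (hy.2 s hs)⟩

theorem isPrimeFree_of_isUnit {u : R} (hu : IsUnit u) : IsPrimeFree u :=
  ⟨hu.ne_zero, fun _ hs h => hs.not_isUnit (isUnit_of_dvd_unit h hu)⟩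

theorem IsPrimeFree.pow {x : R} (hx : IsPrimeFree x) (n : ℕ) : IsPrimeFree (x ^ n) := by
  induction n with
  | zero => simpa using isPrimeFree_of_isUnit isUnit_one
  | succ n ih => exact pow_succ x n ▸ ih.mul hx

theorem IsPrimeFree.prod {ι : Type*} (s : Finset ι) (f : ι → R)
    (h : ∀ i ∈ s, IsPrimeFree (f i)) : IsPrimeFree (∏ i ∈ s, f i) :=
  Finset.prod_induction f IsPrimeFree (fun _ _ => .mul) (isPrimeFree_of_isUnit isUnit_one) h

theorem isPrimeFree_of_irreducible {b : R} (hb : Irreducible b) (hb' : ¬ Prime b) :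
    IsPrimeFree b :=
  ⟨hb.ne_zero, fun _ hs h => hb' ((hs.irreducible.associated_of_dvd hb h).prime hs)⟩

/-- Every nonzero element is a product of prime elements times a prime-free element. -/
theorem IsAtomicDomain.exists_eq_prod_mul (hat : IsAtomicDomain R) (x : R) (hx : x ≠ 0) :
    ∃ (m : Multiset R) (h : R), (∀ s ∈ m, Prime s) ∧ IsPrimeFree h ∧ x = m.prod * h := by
  refine hat.induction (P := fun x => ∃ (m : Multiset R) (h : R), (∀ s ∈ m, Prime s) ∧
    IsPrimeFree h ∧ x = m.prod * h) ?_ ?_ x hx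
  · exact fun u hu => ⟨0, u, by simp, isPrimeFree_of_isUnit hu, by simp⟩
  · rintro b _ hb hx ⟨m, h, hm, hh, rfl⟩
    by_cases hp : Prime b
    · refine ⟨b ::ₘ m, h, ?_, hh, by rw [Multiset.prod_cons, mul_assoc]⟩
      simpa [hp] using hm
    · exact ⟨m, b * h, hm, (isPrimeFree_of_irreducible hb hp).mul hh, by ring⟩

theorem IsPrimeFree.dvd_of_dvd_prime_mul {h s y : R} (hh : IsPrimeFree h) (hs : Prime s)
    (hd : h ∣ s * y) : h ∣ y := by
  obtain ⟨w, hw⟩ := hd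
  obtain ⟨w', rfl⟩ := (hs.dvd_or_dvd (hw ▸ Dvd.intro y rfl)).resolve_left (hh.2 s hs)
  exact ⟨w', mul_left_cancel₀ hs.ne_zero (by rw [hw]; ring)⟩

theorem IsPrimeFree.isPrimeSaturated_span {h : R} (hh : IsPrimeFree h) :
    IsPrimeSaturated (Ideal.span {h}) := fun s x hs hx => by
  rw [Ideal.mem_span_singleton] at *
  exact hh.dvd_of_dvd_prime_mul hs hx

/-! ### Primes with finitely many atoms have height at most one -/

/-- A prime ideal of an atomic domain is generated by representatives of the atoms in it. -/
theorem IsAtomicDomain.eq_span_atoms (hat : IsAtomicDomain R) (p : Ideal R) [hp : p.IsPrime]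
    {A : Set R} (hA : ∀ b ∈ p, Irreducible b → ∃ b' ∈ A, Associated b b') :
    p = Ideal.span (A ∩ p) := by
  apply le_antisymm
  · intro x hxp
    by_cases hx : x = 0
    · simp [hx]
    revert hxp
    refine hat.induction (P := fun x => x ∈ p → x ∈ Ideal.span (A ∩ p)) ?_ ?_ x hx
    · exact fun u hu hup => absurd (p.eq_top_of_isUnit_mem hup hu) hp.ne_top
    · intro b x hb hx ih hxp
      rcases hp.mem_or_mem hxp with h | h
      · obtain ⟨b', hb', hbb⟩ := hA b h hb
        refine Ideal.mul_mem_right _ _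
          (Ideal.mem_of_dvd _ hbb.symm.dvd (Ideal.subset_span ⟨hb', ?_⟩))
        exact Ideal.mem_of_dvd _ hbb.dvd h
      · exact Ideal.mul_mem_left _ _ (ih h)
  · exact Ideal.span_le.2 Set.inter_subset_right

theorem exists_finite_representatives {P : R → Prop}
    (hP : {a : Associates R | ∃ b, Associates.mk b = a ∧ P b}.Finite) :
    ∃ A : Finset R, (∀ b ∈ A, P b) ∧ ∀ b, P b → ∃ b' ∈ A, Associated b b' := by
  classical
  choose! f hf using fun (a : Associates R)
    (ha : a ∈ {a : Associates R | ∃ b, Associates.mk b = a ∧ P b}) => ha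
  refine ⟨hP.toFinset.image f, ?_, ?_⟩
  · intro b hb
    obtain ⟨a, ha, rfl⟩ := Finset.mem_image.1 hb
    exact (hf a (hP.mem_toFinset.1 ha)).2
  · intro b hb
    have hm : Associates.mk b ∈ {a : Associates R | ∃ b, Associates.mk b = a ∧ P b} :=
      ⟨b, rfl, hb⟩
    exact ⟨_, Finset.mem_image_of_mem f (hP.mem_toFinset.2 hm),
      (Associates.mk_eq_mk_iff_associated.1 (hf _ hm).1).symm⟩

/-- A prime ideal `q` with only finitely many atoms up to associates has height at most one. The
primes inside `q` are generated by some of these atoms; so there are only finitely many of them, and the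
localization at `q` is Noetherian by Cohen's theorem. By prime avoidance, `q` is minimal over a
single element, and Krull's height theorem applies. -/
theorem IsAtomicDomain.eq_of_le_of_finite_atoms (hat : IsAtomicDomain R) {p q : Ideal R}
    [hp : p.IsPrime] [hq : q.IsPrime] (hp0 : p ≠ ⊥) (hpq : p ≤ q)
    (hfin : {a : Associates R | ∃ b, Associates.mk b = a ∧ Irreducible b ∧ b ∈ q}.Finite) :
    p = q := by
  classical
  obtain ⟨A, hA, hA'⟩ := exists_finite_representatives hfin
  have key : ∀ p' : Ideal R, p'.IsPrime → p' ≤ q → p' = Ideal.span ((A : Set R) ∩ p') := by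
    intro p' h1 h2
    exact hat.eq_span_atoms p' fun b hb hb' => hA' b ⟨hb', h2 hb⟩
  have hfin' : {p' : Ideal R | p'.IsPrime ∧ p' < q}.Finite := by
    refine Set.Finite.subset
      (Set.Finite.image (fun s : Set R => Ideal.span s) (A.finite_toSet.powerset)) ?_
    rintro p' ⟨h1, h2⟩
    exact ⟨_, Set.inter_subset_left, (key p' h1 h2.le).symm⟩
  by_contra hne
  have hlt : p < q := lt_of_le_of_ne hpq hne
  obtain ⟨x, hxq, hx⟩ : ∃ x ∈ q, ∀ p' : Ideal R, p'.IsPrime → p' < q → x ∉ p' := by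
    by_contra! hcon
    have : (q : Set R) ⊆ ⋃ i ∈ (hfin'.toFinset : Set (Ideal R)), (i : Set R) := by
      intro x hx
      obtain ⟨p', h1, h2, h3⟩ := hcon x hx
      simp only [Set.mem_iUnion]
      exact ⟨p', by simpa using ⟨h1, h2⟩, h3⟩
    rw [Ideal.subset_union_prime (f := fun i : Ideal R => i) ⊥ ⊥
      (fun i hi _ _ => by simpa using ((hfin'.mem_toFinset.1 hi).1))] at this
    obtain ⟨i, hi, hqi⟩ := this
    exact absurd (hfin'.mem_toFinset.1 hi).2 (not_lt_of_ge hqi)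
  let D := Localization.AtPrime q
  have hcomap : ∀ P : Ideal D, P.IsPrime →
      (P.under R).IsPrime ∧ P.under R ≤ q := by
    intro P hP
    have := (IsLocalization.isPrime_iff_isPrime_disjoint q.primeCompl D P).1 hP
    refine ⟨this.1, fun x hx => ?_⟩
    by_contra hxq
    exact Set.disjoint_left.1 this.2 hxq hx
  have hnoeth : IsNoetherianRing D := by
    refine IsNoetherianRing.of_prime fun P hP => ?_
    rw [← IsLocalization.map_under q.primeCompl D P]
    apply Ideal.FG.map
    obtain ⟨h1, h2⟩ := hcomap P hP
    rw [key _ h1 h2]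
    exact Submodule.fg_span (A.finite_toSet.subset Set.inter_subset_left)
  let M := IsLocalRing.maximalIdeal D
  have hMq : M.under R = q := IsLocalization.AtPrime.under_maximalIdeal D q
  have hmin : M ∈ (Ideal.span {algebraMap R D x}).minimalPrimes := by
    refine ⟨⟨inferInstance, ?_⟩, ?_⟩
    · rw [Ideal.span_singleton_le_iff_mem]
      have : x ∈ M.under R := by rwa [hMq]
      exact this
    · rintro P ⟨hP, hxP⟩ hPM
      obtain ⟨h1, h2⟩ := hcomap P hP
      have hxP' : x ∈ P.under R :=
        (Ideal.span_singleton_le_iff_mem (I := P)).1 hxP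
      have heq : P.under R = q := by
        by_contra hne
        exact hx _ h1 (lt_of_le_of_ne h2 hne) hxP'
      rw [← IsLocalization.map_under q.primeCompl D P, heq]
      exact (IsLocalization.AtPrime.map_eq_maximalIdeal q D).ge
  have h1 := Ideal.height_le_one_of_isPrincipal_of_mem_minimalPrimes _ M hmin
  have hdisj : Disjoint (q.primeCompl : Set R) (p : Set R) :=
    Set.disjoint_left.2 fun y hy hyp => hy (hpq hyp)
  have hpP : (p.map (algebraMap R D)).IsPrime :=
    IsLocalization.isPrime_of_isPrime_disjoint q.primeCompl D p hp hdisj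
  have hpc : (p.map (algebraMap R D)).under R = p :=
    IsLocalization.under_map_of_isPrime_disjoint q.primeCompl D hp hdisj
  have hlt1 : (⊥ : Ideal D) < p.map (algebraMap R D) := by
    rw [bot_lt_iff_ne_bot]
    intro h0
    refine hp0 ((Submodule.eq_bot_iff p).2 fun y hy => ?_)
    have hy' : algebraMap R D y ∈ p.map (algebraMap R D) := Ideal.mem_map_of_mem _ hy
    rw [h0, Ideal.mem_bot] at hy'
    exact IsLocalization.injective D q.primeCompl_le_nonZeroDivisors (by simpa using hy')
  have hlt2 : p.map (algebraMap R D) < M := by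
    refine lt_of_le_of_ne (IsLocalRing.le_maximalIdeal hpP.ne_top) fun h => hne ?_
    rw [← hpc, h, hMq]
  have h3 := Ideal.height_add_one_le_of_lt_of_isPrime hlt1
  have h4 := Ideal.height_add_one_le_of_lt_of_isPrime hlt2
  have h5 : (2 : ℕ∞) ≤ 1 := calc
    (2 : ℕ∞) = 0 + 1 + 1 := by norm_num
    _ ≤ (⊥ : Ideal D).height + 1 + 1 := by gcongr; exact zero_le
    _ ≤ M.height := (add_le_add_left h3 1).trans h4
    _ ≤ 1 := h1
  exact absurd h5 (by norm_num)

end Atomic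

/-! ### Prime ideals without prime elements -/

section PrimeFreePrimes

/-- The nonzero prime ideals that contain no prime element. -/
def primeFreePrimes (R : Type*) [CommRing R] : Set (Ideal R) :=
  {p | p.IsPrime ∧ p ≠ ⊥ ∧ ∀ s ∈ p, ¬ Prime s}

variable {R : Type*} [CommRing R]

/-- The radical of a nonzero prime-saturated ideal is the intersection of prime ideals without
prime elements: an ideal maximal among those avoiding the powers of `x` and the products of
prime elements is such a prime. -/
theorem IsPrimeSaturated.exists_pow_mem {I : Ideal R} (hI : IsPrimeSaturated I) (h0 : I ≠ ⊥)
    {x : R} (hx : ∀ p ∈ primeFreePrimes R, I ≤ p → x ∈ p) : ∃ n : ℕ, x ^ n ∈ I := by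
  by_contra! hcon
  let S : Submonoid R := Submonoid.closure {s | Prime s} ⊔ Submonoid.powers x
  have hS : ∀ t ∈ Submonoid.closure {s : R | Prime s}, ∀ y, t * y ∈ I → y ∈ I := by
    intro t ht
    induction ht using Submonoid.closure_induction with
    | mem s hs => exact fun y => hI s y hs
    | one => simp
    | mul a b _ _ ha hb => exact fun y hy => hb y (ha _ (by rwa [← mul_assoc]))
  have hdisj : Disjoint (I : Set R) S := by
    refine Set.disjoint_left.2 fun y hy hyS => ?_
    obtain ⟨t, ht, z, ⟨n, rfl⟩, rfl⟩ := Submonoid.mem_sup.1 hyS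
    exact hcon n (hS t ht _ hy)
  obtain ⟨p, hp, hIp, hpS⟩ := Ideal.exists_le_prime_disjoint I S hdisj
  have hxS : x ∈ S := Submonoid.mem_sup_right (Submonoid.mem_powers x)
  refine Set.disjoint_left.1 hpS (hx p ⟨hp, ne_bot_of_le_ne_bot h0 hIp, fun s hs hs' => ?_⟩ hIp) hxS
  exact Set.disjoint_left.1 hpS hs (Submonoid.mem_sup_left (Submonoid.subset_closure hs'))

/-- A nonzero prime-saturated ideal that lies in no prime ideal without prime elements is `R`. This
plays the role of the comaximality arguments in the localization at the prime elements. -/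
theorem IsPrimeSaturated.eq_top {I : Ideal R} (hI : IsPrimeSaturated I) (h0 : I ≠ ⊥)
    (h : ∀ p ∈ primeFreePrimes R, ¬ I ≤ p) : I = ⊤ := by
  obtain ⟨n, hn⟩ := hI.exists_pow_mem h0 (x := 1) fun p hp hp' => absurd hp' (h p hp)
  rw [one_pow] at hn
  exact (Ideal.eq_top_iff_one I).2 hn

theorem prod_notMem_of_mem_primeFreePrimes {p : Ideal R} (hp : p ∈ primeFreePrimes R)
    {m : Multiset R} (hm : ∀ s ∈ m, Prime s) : m.prod ∉ p := by
  have := hp.1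
  intro h
  obtain ⟨s, hs, hsp⟩ := (Ideal.IsPrime.multiset_prod_mem_iff_exists_mem this m).1 h
  exact hp.2.2 s hsp (hm s hs)

variable [IsDomain R]

/-- A finite set of representatives of the atoms that are not prime elements. -/
theorem IsGeneralizedCohenKaplansky.exists_atoms (hR : IsGeneralizedCohenKaplansky R) :
    ∃ A : Finset R, (∀ b ∈ A, Irreducible b ∧ ¬ Prime b) ∧
      ∀ b, Irreducible b → ¬ Prime b → ∃ b' ∈ A, Associated b b' := by
  obtain ⟨A, h1, h2⟩ := exists_finite_representatives hR.2.2
  exact ⟨A, h1, fun b hb hb' => h2 b ⟨hb, hb'⟩⟩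

theorem IsGeneralizedCohenKaplansky.finite_primeFreePrimes
    (hR : IsGeneralizedCohenKaplansky R) : (primeFreePrimes R).Finite := by
  obtain ⟨A, -, hA⟩ := hR.exists_atoms
  refine Set.Finite.subset
    (Set.Finite.image (fun s : Set R => Ideal.span s) (A.finite_toSet.powerset)) ?_
  rintro p ⟨h1, h2, h3⟩
  exact ⟨_, Set.inter_subset_left,
    (hR.2.1.eq_span_atoms p fun b hb hb' => hA b hb' (h3 b hb)).symm⟩

theorem IsGeneralizedCohenKaplansky.fg_of_mem_primeFreePrimes
    (hR : IsGeneralizedCohenKaplansky R) {p : Ideal R}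
    (hp : p ∈ primeFreePrimes R) : p.FG := by
  obtain ⟨A, -, hA⟩ := hR.exists_atoms
  have := hp.1
  rw [hR.2.1.eq_span_atoms p fun b hb hb' => hA b hb' (hp.2.2 b hb)]
  exact Submodule.fg_span (A.finite_toSet.subset Set.inter_subset_left)

/-- The primes without prime elements have height one. -/
theorem IsGeneralizedCohenKaplansky.eq_of_le
    (hR : IsGeneralizedCohenKaplansky R) {p q : Ideal R} (hp : p.IsPrime) (hp0 : p ≠ ⊥)
    (hq : q ∈ primeFreePrimes R) (h : p ≤ q) : p = q := by
  have := hq.1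
  refine hR.2.1.eq_of_le_of_finite_atoms hp0 h (hR.2.2.subset ?_)
  rintro a ⟨b, rfl, hb, hbq⟩
  exact ⟨b, rfl, hb, hq.2.2 b hbq⟩

theorem IsAtomicDomain.span_mem_minNonzeroPrimes (hat : IsAtomicDomain R) {s : R}
    (hs : Prime s) : Ideal.span {s} ∈ minNonzeroPrimes R := by
  refine ⟨⟨(Ideal.span_singleton_prime hs.ne_zero).2 hs, by simpa using hs.ne_zero⟩, ?_⟩
  rintro p ⟨hp, hp0⟩ hps
  obtain ⟨x, hx, hx0⟩ := Submodule.exists_mem_ne_zero_of_ne_bot hp0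
  obtain ⟨b, hb, hbp⟩ : ∃ b, Irreducible b ∧ b ∈ p := by
    revert hx
    refine hat.induction (P := fun x => x ∈ p → ∃ b, Irreducible b ∧ b ∈ p) ?_ ?_ x hx0
    · exact fun u hu hup => absurd (p.eq_top_of_isUnit_mem hup hu) hp.ne_top
    · intro b x hb hx ih hxp
      exact (hp.mem_or_mem hxp).elim (fun h => ⟨b, hb, h⟩) ih
  have hsb : s ∣ b := Ideal.mem_span_singleton.1 (hps hbp)
  rw [Ideal.span_singleton_le_iff_mem]
  exact Ideal.mem_of_dvd _ (hs.irreducible.associated_of_dvd hb hsb).symm.dvd hbp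

theorem IsGeneralizedCohenKaplansky.mem_minNonzeroPrimes_iff
    (hR : IsGeneralizedCohenKaplansky R) {p : Ideal R} :
    p ∈ minNonzeroPrimes R ↔ (∃ s, Prime s ∧ p = Ideal.span {s}) ∨ p ∈ primeFreePrimes R := by
  constructor
  · intro hp
    by_cases h : ∃ s ∈ p, Prime s
    · obtain ⟨s, hsp, hs⟩ := h
      refine .inl ⟨s, hs, le_antisymm ?_ ((Ideal.span_singleton_le_iff_mem _).2 hsp)⟩
      exact hp.2 ⟨(Ideal.span_singleton_prime hs.ne_zero).2 hs, by simpa using hs.ne_zero⟩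
        ((Ideal.span_singleton_le_iff_mem _).2 hsp)
    · push Not at h
      exact .inr ⟨hp.1.1, hp.1.2, h⟩
  · rintro (⟨s, hs, rfl⟩ | hp)
    · exact hR.2.1.span_mem_minNonzeroPrimes hs
    · refine ⟨⟨hp.1, hp.2.1⟩, fun q hq hqp => ?_⟩
      exact (hR.eq_of_le hq.1 hq.2 hp hqp).ge

/-- Prime avoidance among the finitely many primes without prime elements: each of them contains
a prime-free element that lies in no other one. -/
theorem IsGeneralizedCohenKaplansky.exists_separating
    (hR : IsGeneralizedCohenKaplansky R) :
    ∃ c : primeFreePrimes R → R, (∀ i, IsPrimeFree (c i)) ∧ ∀ i j, c i ∈ j.1 ↔ i = j := by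
  have key : ∀ i : primeFreePrimes R, ∃ c : R, IsPrimeFree c ∧ ∀ j : primeFreePrimes R,
      c ∈ j.1 ↔ i = j := by
    intro i
    obtain ⟨x, hxi, hx⟩ : ∃ x ∈ i.1, ∀ j : primeFreePrimes R, i ≠ j → x ∉ j.1 := by
      by_contra! hcon
      have hfin : {j : Ideal R | j ∈ primeFreePrimes R ∧ i.1 ≠ j}.Finite :=
        hR.finite_primeFreePrimes.subset fun j hj => hj.1
      have : (i.1 : Set R) ⊆ ⋃ j ∈ (hfin.toFinset : Set (Ideal R)), (j : Set R) := by
        intro x hx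
        obtain ⟨j, h1, h2⟩ := hcon x hx
        simp only [Set.mem_iUnion]
        exact ⟨j.1, (hfin.mem_toFinset).2 ⟨j.2, fun h => h1 (Subtype.ext h)⟩, h2⟩
      rw [Ideal.subset_union_prime (f := fun i : Ideal R => i) ⊥ ⊥
        (fun j hj _ _ => (hfin.mem_toFinset.1 hj).1.1)] at this
      obtain ⟨j, hj, hij⟩ := this
      have hj' := hfin.mem_toFinset.1 hj
      exact hj'.2 (hR.eq_of_le i.2.1 i.2.2.1 hj'.1 hij)
    by_cases hx0 : x = 0
    · -- then there is no other such prime, and any nonzero element will do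
      have hall : ∀ j : primeFreePrimes R, i = j := by
        intro j
        by_contra hij
        exact hx j hij (hx0 ▸ j.1.zero_mem)
      obtain ⟨y, hy, hy0⟩ := Submodule.exists_mem_ne_zero_of_ne_bot i.2.2.1
      obtain ⟨m, h, hm, hh, rfl⟩ := hR.2.1.exists_eq_prod_mul y hy0
      refine ⟨h, hh, fun j => ⟨fun _ => hall j, ?_⟩⟩
      rintro rfl
      exact (i.2.1.mem_or_mem hy).resolve_left (prod_notMem_of_mem_primeFreePrimes i.2 hm)
    obtain ⟨m, h, hm, hh, rfl⟩ := hR.2.1.exists_eq_prod_mul x hx0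
    refine ⟨h, hh, fun j => ⟨fun hj => ?_, ?_⟩⟩
    · by_contra hij
      exact hx j hij (Ideal.mul_mem_left _ _ hj)
    · rintro rfl
      exact (i.2.1.mem_or_mem hxi).resolve_left (prod_notMem_of_mem_primeFreePrimes i.2 hm)
  choose c h1 h2 using key
  exact ⟨c, h1, h2⟩

theorem IsPrimeFree.exists_mem_primeFreePrimes {h : R} (hh : IsPrimeFree h) (hu : ¬ IsUnit h) :
    ∃ p ∈ primeFreePrimes R, h ∈ p := by
  by_contra! hcon
  refine hu (Ideal.span_singleton_eq_top.1
    (hh.isPrimeSaturated_span.eq_top (by simpa using hh.1) ?_))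
  exact fun p hp hle => hcon p hp ((Ideal.span_singleton_le_iff_mem _).1 hle)

end PrimeFreePrimes

/-! ### Prime-free elements up to powers -/

section Powers

variable {R : Type*} [CommRing R]

/-- The elements some positive power of which lies in `N`. -/
def rootSubmonoid (N : Submonoid R) : Submonoid R where
  carrier := {x | ∃ e : ℕ, 0 < e ∧ x ^ e ∈ N}
  one_mem' := ⟨1, one_pos, by simp⟩
  mul_mem' := by
    rintro x y ⟨e, he, hx⟩ ⟨f, hf, hy⟩
    refine ⟨e * f, Nat.mul_pos he hf, ?_⟩
    rw [mul_pow, pow_mul, mul_comm e f, pow_mul]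
    exact mul_mem (pow_mem hx f) (pow_mem hy e)

theorem rootSubmonoid_le {N N' : Submonoid R} (h : N ≤ rootSubmonoid N') :
    rootSubmonoid N ≤ rootSubmonoid N' := by
  rintro x ⟨e, he, hx⟩
  obtain ⟨f, hf, hxf⟩ := h hx
  exact ⟨e * f, Nat.mul_pos he hf, by rwa [pow_mul]⟩

theorem le_rootSubmonoid (N : Submonoid R) : N ≤ rootSubmonoid N :=
  fun x hx => ⟨1, one_pos, by simpa using hx⟩

/-- The submonoid generated by `A` and the units. -/
def unitsClosure (A : Set R) : Submonoid R := Submonoid.closure (A ∪ {u | IsUnit u})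

theorem mem_unitsClosure_of_mem {A : Set R} {x : R} (hx : x ∈ A) : x ∈ unitsClosure A :=
  Submonoid.subset_closure (.inl hx)

theorem mem_unitsClosure_of_isUnit {A : Set R} {x : R} (hx : IsUnit x) : x ∈ unitsClosure A :=
  Submonoid.subset_closure (.inr hx)

theorem exists_pow_mul_of_mem_unitsClosure {A : Set R} {a x : R}
    (hx : x ∈ unitsClosure A) : ∃ k : ℕ, ∃ w ∈ unitsClosure (A \ {a}), x = a ^ k * w := by
  induction hx using Submonoid.closure_induction with
  | mem y hy =>
    rcases hy with hy | hy
    · by_cases hya : y = a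
      · exact ⟨1, 1, one_mem _, by simp [hya]⟩
      · exact ⟨0, y, mem_unitsClosure_of_mem ⟨hy, hya⟩, by simp⟩
    · exact ⟨0, y, mem_unitsClosure_of_isUnit hy, by simp⟩
  | one => exact ⟨0, 1, one_mem _, by simp⟩
  | mul y z _ _ hy hz =>
    obtain ⟨k, w, hw, rfl⟩ := hy
    obtain ⟨l, v, hv, rfl⟩ := hz
    exact ⟨k + l, w * v, mul_mem hw hv, by ring⟩

theorem unitsClosure_le_rootSubmonoid {A : Set R} {N : Submonoid R} (hA : A ⊆ rootSubmonoid N)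
    (hN : ∀ u, IsUnit u → u ∈ N) : unitsClosure A ≤ rootSubmonoid N := by
  refine Submonoid.closure_le.2 (Set.union_subset hA fun u hu => ?_)
  exact le_rootSubmonoid N (hN u hu)

variable [IsDomain R]

theorem IsAtomicDomain.isPrimeFree_mem_unitsClosure (hat : IsAtomicDomain R) {A : Set R}
    (hA : ∀ b, Irreducible b → ¬ Prime b → ∃ b' ∈ A, Associated b b') {h : R}
    (hh : IsPrimeFree h) : h ∈ unitsClosure A := by
  have key := hat.induction (P := fun x => IsPrimeFree x → x ∈ unitsClosure A)
    (fun u hu _ => mem_unitsClosure_of_isUnit hu) ?_ h hh.1 hh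
  · exact key
  · intro b x hb hx ih hbx
    refine mul_mem ?_ (ih (hbx.of_dvd (Dvd.intro_left _ rfl)))
    obtain ⟨b', hb', u, rfl⟩ := hA b hb fun hp => hbx.2 b hp (Dvd.intro _ rfl)
    have := mul_mem (mem_unitsClosure_of_mem hb') (mem_unitsClosure_of_isUnit (u⁻¹).isUnit)
    simpa using this

/-- A power of each prime-free element is, up to a unit, a product of the separating elements
`c i`. To see this, take a minimal set `A` of atoms that generates all prime-free elements up to
units and roots. If `a ∈ A` lies in the prime `i`, then `c i` divides a power of `a`; comparing
exponents, minimality of `A` forces a power of `a` to be associated to a power of `c i`. -/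
theorem IsGeneralizedCohenKaplansky.isPrimeFree_mem_rootSubmonoid
    (hR : IsGeneralizedCohenKaplansky R) {c : primeFreePrimes R → R}
    (hc : ∀ i, IsPrimeFree (c i)) (hc' : ∀ i j, c i ∈ j.1 ↔ i = j) {h : R} (hh : IsPrimeFree h) :
    h ∈ rootSubmonoid (unitsClosure (Set.range c)) := by
  obtain ⟨A₀, hA₀, hA₀'⟩ := hR.exists_atoms
  let F : Set (Finset R) := {A | (∀ b ∈ A, Irreducible b ∧ ¬ Prime b) ∧
    ∀ h : R, IsPrimeFree h → h ∈ rootSubmonoid (unitsClosure (A : Set R))}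
  have hne : F.Nonempty := ⟨A₀, hA₀, fun h hh =>
    le_rootSubmonoid _ (hR.2.1.isPrimeFree_mem_unitsClosure hA₀' hh)⟩
  obtain ⟨A, ⟨hA, hA'⟩, hmin⟩ := (wellFounded_lt (α := Finset R)).has_min F hne
  have hAc : (A : Set R) ⊆ rootSubmonoid (unitsClosure (Set.range c)) := by
    classical
    intro a ha
    have haf : IsPrimeFree a := isPrimeFree_of_irreducible (hA a ha).1 (hA a ha).2
    obtain ⟨p, hp, hap⟩ := haf.exists_mem_primeFreePrimes (hA a ha).1.not_isUnit
    obtain ⟨n, hn⟩ := (hc ⟨p, hp⟩).isPrimeSaturated_span.exists_pow_mem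
      (by simpa using (hc ⟨p, hp⟩).1) (x := a) (by
        intro q hq hle
        have := (hc' ⟨p, hp⟩ ⟨q, hq⟩).1 ((Ideal.span_singleton_le_iff_mem _).1 hle)
        obtain rfl : p = q := congrArg Subtype.val this
        exact hap)
    obtain ⟨z, hz⟩ := Ideal.mem_span_singleton.1 hn
    obtain ⟨e, he, hce⟩ := hA' _ (hc ⟨p, hp⟩)
    obtain ⟨f, hf, hzf⟩ := hA' z ((haf.pow n).of_dvd ⟨c ⟨p, hp⟩, by rw [hz, mul_comm]⟩)
    obtain ⟨k, w, hw, hk⟩ := exists_pow_mul_of_mem_unitsClosure (a := a) (pow_mem hce f)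
    obtain ⟨l, v, hv, hl⟩ := exists_pow_mul_of_mem_unitsClosure (a := a) (pow_mem hzf e)
    have heq : a ^ (n * (e * f)) = a ^ (k + l) * (w * v) := by
      rw [pow_mul, hz, mul_pow, pow_mul, hk, mul_comm e f, pow_mul, hl]
      ring
    rcases lt_or_ge (k + l) (n * (e * f)) with hlt | hge
    · exfalso
      obtain ⟨d, hd⟩ := Nat.exists_eq_add_of_lt hlt
      have had : a ^ (d + 1) ∈ unitsClosure ((A : Set R) \ {a}) := by
        have : a ^ (d + 1) = w * v := by
          apply mul_left_cancel₀ (pow_ne_zero (k + l) haf.1)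
          rw [← heq, hd, ← pow_add]
          congr 1
        exact this ▸ mul_mem hw hv
      refine hmin (A.erase a) ⟨fun b hb => hA b (Finset.mem_of_mem_erase hb), fun x hx => ?_⟩
        (Finset.erase_ssubset ha)
      refine rootSubmonoid_le (unitsClosure_le_rootSubmonoid ?_
        fun u hu => mem_unitsClosure_of_isUnit hu) (hA' x hx)
      intro b hb
      by_cases hba : b = a
      · exact ⟨d + 1, d.succ_pos, by simpa [hba] using had⟩
      · exact le_rootSubmonoid _ (mem_unitsClosure_of_mem (by simp [hba, Finset.mem_coe.1 hb]))
    · obtain ⟨d, hd⟩ := Nat.exists_eq_add_of_le hge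
      have hu : IsUnit (a ^ d * (w * v)) := by
        have : 1 = a ^ d * (w * v) := by
          apply mul_left_cancel₀ (pow_ne_zero (n * (e * f)) haf.1)
          rw [mul_one]
          conv_lhs => rw [heq, hd]
          ring
        exact this ▸ isUnit_one
      have hw' : IsUnit w := isUnit_of_dvd_unit ⟨a ^ d * v, by ring⟩ hu
      have hk0 : 0 < k := by
        rcases Nat.eq_zero_or_pos k with rfl | h0
        · exfalso
          have hcu : IsUnit (c ⟨p, hp⟩) := by
            refine isUnit_of_dvd_unit (dvd_pow_self _ (Nat.mul_pos he hf).ne') ?_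
            rw [pow_mul, hk]
            simpa using hw'
          exact hp.1.ne_top (p.eq_top_of_isUnit_mem ((hc' ⟨p, hp⟩ ⟨p, hp⟩).2 rfl) hcu)
        · exact h0
      obtain ⟨w', rfl⟩ := hw'
      refine ⟨k, hk0, ?_⟩
      have : a ^ k = (c ⟨p, hp⟩ ^ e) ^ f * ((w'⁻¹ : Rˣ) : R) := by simp [hk, mul_assoc]
      rw [this]
      exact mul_mem (pow_mem (pow_mem (mem_unitsClosure_of_mem (Set.mem_range_self _)) _) _)
        (mem_unitsClosure_of_isUnit (Units.isUnit _))
  exact rootSubmonoid_le (unitsClosure_le_rootSubmonoid hAc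
    fun u hu => mem_unitsClosure_of_isUnit hu) (hA' h hh)

end Powers

/-! ### Normal forms of prime-free elements -/

section NormalForm

theorem exists_associated_prod_pow {R ι : Type*} [CommRing R] [Fintype ι] {c : ι → R} {x : R}
    (hx : x ∈ unitsClosure (Set.range c)) : ∃ n : ι → ℕ, Associated x (∏ i, c i ^ n i) := by
  classical
  induction hx using Submonoid.closure_induction with
  | mem y hy =>
    rcases hy with ⟨i, rfl⟩ | hy
    · exact ⟨Pi.single i 1, by simp [Pi.single_apply]⟩
    · exact ⟨0, by simpa using associated_one_iff_isUnit.2 hy⟩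
  | one => exact ⟨0, by simp⟩
  | mul y z _ _ hy hz =>
    obtain ⟨n, hn⟩ := hy
    obtain ⟨m, hm⟩ := hz
    refine ⟨n + m, ?_⟩
    simpa [pow_add, Finset.prod_mul_distrib] using hn.mul_mul hm

/-- A system of prime-free elements `c i`, one for each prime ideal `i` without prime elements and
lying in `i` only, such that every prime-free element is, up to a unit, a product of powers of the
`c i` and an element of a fixed finite set `F`; the `E`-th powers of the elements of `F` are
themselves products of powers of the `c i`, with exponents at most `bound`. -/
structure SeparatingSystem (R : Type*) [CommRing R] [Fintype (primeFreePrimes R)] where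
  /-- The separating elements. -/
  c : primeFreePrimes R → R
  /-- The finite set of remainders. -/
  F : Set R
  /-- The exponent that turns remainders into products of powers of separating elements. -/
  E : ℕ
  /-- The bound for the exponents of `E`-th powers of remainders. -/
  bound : ℕ
  isPrimeFree_c : ∀ i, IsPrimeFree (c i)
  c_mem_iff : ∀ i j, c i ∈ j.1 ↔ i = j
  F_finite : F.Finite
  E_pos : 0 < E
  exists_normalForm : ∀ h, IsPrimeFree h →
    ∃ α : primeFreePrimes R → ℕ, ∃ x ∈ F, Associated h ((∏ i, c i ^ α i) * x)
  exists_pow_normalForm : ∀ x ∈ F,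
    ∃ n : primeFreePrimes R → ℕ, (∀ i, n i ≤ bound) ∧ Associated (x ^ E) (∏ i, c i ^ n i)

theorem IsGeneralizedCohenKaplansky.nonempty_separatingSystem {R : Type*} [CommRing R]
    [IsDomain R] [Fintype (primeFreePrimes R)] (hR : IsGeneralizedCohenKaplansky R) :
    Nonempty (SeparatingSystem R) := by
  classical
  obtain ⟨A, hA, hA'⟩ := hR.exists_atoms
  obtain ⟨c, hc, hc'⟩ := hR.exists_separating
  have hroot : ∀ b : A, ∃ e : ℕ, 0 < e ∧ (b : R) ^ e ∈ unitsClosure (Set.range c) := fun b =>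
    hR.isPrimeFree_mem_rootSubmonoid hc hc'
      (isPrimeFree_of_irreducible (hA b b.2).1 (hA b b.2).2)
  choose e he hbe using hroot
  let E := ∏ b, e b
  have hE : 0 < E := Finset.prod_pos fun b _ => he b
  have hbE : ∀ b : A, (b : R) ^ E ∈ unitsClosure (Set.range c) := by
    intro b
    obtain ⟨d, hd⟩ : e b ∣ E := Finset.dvd_prod_of_mem e (Finset.mem_univ b)
    rw [hd, pow_mul]
    exact pow_mem (hbe b) d
  let f : (A → Fin E) → R := fun r => ∏ b : A, (b : R) ^ (r b : ℕ)
  have hpow : ∀ x ∈ Set.range f, ∃ n : primeFreePrimes R → ℕ,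
      Associated (x ^ E) (∏ i, c i ^ n i) := by
    rintro _ ⟨r, rfl⟩
    apply exists_associated_prod_pow
    rw [← Finset.prod_pow]
    refine prod_mem fun b _ => ?_
    rw [← pow_mul, mul_comm, pow_mul]
    exact pow_mem (hbE b) _
  choose! n hn using hpow
  have hfin : (Set.range f).Finite := Set.finite_range f
  refine ⟨⟨c, Set.range f, E, hfin.toFinset.sup fun x => Finset.univ.sup (n x), hc, hc', hfin,
    hE, ?_, ?_⟩⟩
  · intro h hh
    have hmem : h ∈ unitsClosure (Set.range ((↑) : A → R)) :=
      hR.2.1.isPrimeFree_mem_unitsClosure (by simpa using hA') hh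
    obtain ⟨k, hk⟩ := exists_associated_prod_pow hmem
    have hq : ∏ b : A, ((b : R) ^ E) ^ (k b / E) ∈ unitsClosure (Set.range c) :=
      prod_mem fun b _ => pow_mem (hbE b) _
    obtain ⟨α, hα⟩ := exists_associated_prod_pow hq
    refine ⟨α, _, ⟨fun b => ⟨k b % E, Nat.mod_lt _ hE⟩, rfl⟩, hk.trans ?_⟩
    have : ∏ b : A, (b : R) ^ k b =
        (∏ b : A, ((b : R) ^ E) ^ (k b / E)) * ∏ b : A, (b : R) ^ (k b % E) := by
      rw [← Finset.prod_mul_distrib]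
      refine Finset.prod_congr rfl fun b _ => ?_
      rw [← pow_mul, ← pow_add, Nat.div_add_mod]
    rw [this]
    exact hα.mul_right _
  · intro x hx
    refine ⟨n x, fun i => ?_, hn x hx⟩
    exact (Finset.le_sup (f := n x) (Finset.mem_univ i)).trans
      (Finset.le_sup (f := fun x => Finset.univ.sup (n x)) (hfin.mem_toFinset.2 hx))

namespace SeparatingSystem

variable {R : Type*} [CommRing R] [Fintype (primeFreePrimes R)]
  (S : SeparatingSystem R)

/-- The monomial `∏ i, c i ^ α i`. -/
def monomial (α : primeFreePrimes R → ℕ) : R := ∏ i, S.c i ^ α i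

theorem monomial_add (α β : primeFreePrimes R → ℕ) :
    S.monomial (α + β) = S.monomial α * S.monomial β := by
  simp [monomial, pow_add, Finset.prod_mul_distrib]

theorem monomial_nsmul (k : ℕ) (α : primeFreePrimes R → ℕ) :
    S.monomial (k • α) = S.monomial α ^ k := by
  simp only [monomial, ← Finset.prod_pow, Pi.smul_apply, smul_eq_mul]
  exact Finset.prod_congr rfl fun i _ => by rw [mul_comm, pow_mul]

theorem monomial_single [DecidableEq (primeFreePrimes R)] (i : primeFreePrimes R) (k : ℕ) :
    S.monomial (Pi.single i k) = S.c i ^ k := by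
  rw [monomial, Finset.prod_eq_single i]
  · simp
  · intro j _ hj
    simp [hj]
  · simp

theorem monomial_dvd_monomial {α β : primeFreePrimes R → ℕ} (h : α ≤ β) :
    S.monomial α ∣ S.monomial β :=
  Finset.prod_dvd_prod_of_dvd _ _ fun i _ => pow_dvd_pow _ (h i)

theorem monomial_mem_iff (α : primeFreePrimes R → ℕ) (j : primeFreePrimes R) :
    S.monomial α ∈ j.1 ↔ α j ≠ 0 := by
  have := j.2.1
  constructor
  · intro h h0
    obtain ⟨i, -, hi⟩ := (Ideal.IsPrime.prod_mem_iff).1 h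
    have hij := (S.c_mem_iff i j).1 (this.mem_of_pow_mem _ hi)
    subst hij
    rw [h0, pow_zero] at hi
    exact this.ne_top ((Ideal.eq_top_iff_one _).2 hi)
  · intro h0
    exact Ideal.mem_of_dvd _
      ((dvd_pow_self _ h0).trans (Finset.dvd_prod_of_mem _ (Finset.mem_univ j)))
      ((S.c_mem_iff j j).2 rfl)

theorem dvd_monomial_of_mem {x : R} (hx : x ∈ S.F) : x ∣ S.monomial fun _ => S.bound := by
  obtain ⟨n, hn, hxn⟩ := S.exists_pow_normalForm x hx
  exact (dvd_pow_self x S.E_pos.ne').trans (hxn.dvd.trans (S.monomial_dvd_monomial hn))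

theorem exists_pow_associated {h : R} (hh : IsPrimeFree h) :
    ∃ n, Associated (h ^ S.E) (S.monomial n) := by
  obtain ⟨α, x, hx, hα⟩ := S.exists_normalForm h hh
  obtain ⟨n, -, hn⟩ := S.exists_pow_normalForm x hx
  refine ⟨S.E • α + n, (hα.pow_pow).trans ?_⟩
  rw [mul_pow, monomial_add, monomial_nsmul]
  exact hn.mul_left _

theorem exists_dvd_monomial {h : R} (hh : IsPrimeFree h) : ∃ n, h ∣ S.monomial n := by
  obtain ⟨n, hn⟩ := S.exists_pow_associated hh
  exact ⟨n, (dvd_pow_self h S.E_pos.ne').trans hn.dvd⟩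

variable [IsDomain R]

theorem isPrimeFree_monomial (α : primeFreePrimes R → ℕ) : IsPrimeFree (S.monomial α) :=
  .prod _ _ fun i _ => (S.isPrimeFree_c i).pow _

theorem le_of_monomial_dvd_monomial {α β : primeFreePrimes R → ℕ}
    (h : S.monomial α ∣ S.monomial β) : α ≤ β := by
  classical
  intro j
  by_contra! hlt
  -- cancelling `c j ^ β j` leaves a monomial without `c j` that is divisible by `c j`
  have h1 : S.monomial (Pi.single j (β j)) * S.c j ∣ S.monomial α := by
    rw [monomial_single, ← pow_succ, ← monomial_single]
    refine S.monomial_dvd_monomial fun i => ?_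
    by_cases hij : i = j
    · subst hij
      simpa using hlt
    · simp [hij]
  have h2 : S.monomial β = S.monomial (Pi.single j (β j)) * S.monomial (Function.update β j 0) := by
    rw [← monomial_add]
    congr 1
    ext i
    by_cases hij : i = j
    · subst hij
      simp
    · simp [hij]
  have h3 := h1.trans h
  rw [h2, mul_dvd_mul_iff_left (S.isPrimeFree_monomial _).1] at h3
  have h4 := Ideal.mem_of_dvd _ h3 ((S.c_mem_iff j j).2 rfl)
  rw [monomial_mem_iff] at h4
  simp at h4

end SeparatingSystem

end NormalForm

/-! ### The conductor -/

section Conductor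

variable {R : Type*} [CommRing R]

theorem mem_conductor_iff {f : R} : f ∈ conductor R ↔
    ∀ q ∈ completeIntegralClosure R, algebraMap R (FractionRing R) f * q ∈ base R := Iff.rfl

variable [IsDomain R]

theorem IsPrimeFree.dvd_of_dvd_prod_mul {h : R} (hh : IsPrimeFree h) {m : Multiset R}
    (hm : ∀ s ∈ m, Prime s) {y : R} (hd : h ∣ m.prod * y) : h ∣ y := by
  rw [← Ideal.mem_span_singleton] at *
  exact hh.isPrimeSaturated_span.mem_of_prod_mul_mem hm hd

/-- If `y / z` is almost integral and `z` is prime-free, then a fixed monomial times `y / z` lies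
in `R`: comparing exponents in `z ^ n ∣ c * y ^ n` for large `n` shows that, up to a bounded error,
the exponents of `z` do not exceed those of `y`. -/
theorem SeparatingSystem.dvd_monomial_mul_of_isPrimeFree [Fintype (primeFreePrimes R)]
    (hat : IsAtomicDomain R) (S : SeparatingSystem R) {c y z : R} (hc : c ≠ 0)
    (hz : IsPrimeFree z) (h : ∀ n : ℕ, z ^ n ∣ c * y ^ n) :
    z ∣ S.monomial (fun _ => 2 * S.bound) * y := by
  by_cases hy0 : y = 0
  · simp [hy0]
  obtain ⟨m, y, hm, hy, rfl⟩ := hat.exists_eq_prod_mul y hy0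
  obtain ⟨m', c, hm', hc', rfl⟩ := hat.exists_eq_prod_mul c hc
  have h' : ∀ n : ℕ, z ^ n ∣ c * y ^ n := by
    intro n
    have h1 := h n
    rw [mul_assoc] at h1
    have h2 := (hz.pow n).dvd_of_dvd_prod_mul hm' h1
    have h3 : c * (m.prod * y) ^ n = (n • m).prod * (c * y ^ n) := by
      rw [Multiset.prod_nsmul]
      ring
    rw [h3] at h2
    refine (hz.pow n).dvd_of_dvd_prod_mul (fun s hs => hm s ?_) h2
    exact Multiset.mem_of_mem_nsmul hs
  obtain ⟨α, y₀, hy₀, hα⟩ := S.exists_normalForm y hy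
  obtain ⟨β, z₀, hz₀, hβ⟩ := S.exists_normalForm z hz
  obtain ⟨k, hk⟩ := S.exists_pow_associated hc'
  obtain ⟨n₀, hn₀, hyn⟩ := S.exists_pow_normalForm y₀ hy₀
  have hle : ∀ i, β i ≤ α i + S.bound := by
    intro i
    by_contra! hlt
    let N := k i + 1
    have h1 : S.monomial ((S.E * N) • β) ∣ S.monomial (k + N • (S.E • α + n₀)) := by
      have e1 : S.monomial ((S.E * N) • β) ∣ (z ^ N) ^ S.E := by
        rw [S.monomial_nsmul, ← pow_mul, mul_comm]
        exact pow_dvd_pow_of_dvd ((Dvd.intro _ rfl : _ ∣ S.monomial β * z₀).trans hβ.symm.dvd) _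
      have e2 : Associated ((c * y ^ N) ^ S.E) (S.monomial (k + N • (S.E • α + n₀))) := by
        rw [mul_pow, S.monomial_add, S.monomial_nsmul, S.monomial_add, S.monomial_nsmul,
          ← pow_mul, mul_comm N, pow_mul]
        refine hk.mul_mul (Associated.pow_pow (hα.pow_pow.trans ?_))
        rw [mul_pow]
        exact hyn.mul_left _
      exact e1.trans ((pow_dvd_pow_of_dvd (h' N) _).trans e2.dvd)
    have h2 := S.le_of_monomial_dvd_monomial h1 i
    simp only [Pi.smul_apply, Pi.add_apply, smul_eq_mul] at h2
    have h3 : S.E * α i + n₀ i + 1 ≤ S.E * β i := by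
      have := hn₀ i
      have := S.E_pos
      nlinarith
    have h4 : N * (S.E * α i + n₀ i + 1) ≤ N * (S.E * β i) := Nat.mul_le_mul_left _ h3
    have h5 : S.E * N * β i = N * (S.E * β i) := by ring
    have h6 : N = k i + 1 := rfl
    rw [mul_add, mul_one] at h4
    omega
  calc z ∣ S.monomial β * z₀ := hβ.dvd
    _ ∣ S.monomial β * S.monomial (fun _ => S.bound) :=
      mul_dvd_mul_left _ (S.dvd_monomial_of_mem hz₀)
    _ ∣ S.monomial ((fun _ => 2 * S.bound) + α) := by
      rw [← S.monomial_add]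
      refine S.monomial_dvd_monomial fun i => ?_
      have := hle i
      simp only [Pi.add_apply]
      omega
    _ ∣ S.monomial (fun _ => 2 * S.bound) * y := by
      rw [S.monomial_add]
      exact mul_dvd_mul_left _ ((Dvd.intro _ rfl : _ ∣ S.monomial α * y₀).trans hα.symm.dvd)
    _ ∣ S.monomial (fun _ => 2 * S.bound) * (m.prod * y) :=
      mul_dvd_mul_left _ (Dvd.intro_left _ rfl)

/-- The denominator need not be prime-free: a prime element that divides `z` divides `y` as well,
because `c` is divisible by only finitely many of its powers. -/
theorem SeparatingSystem.dvd_monomial_mul [Fintype (primeFreePrimes R)]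
    (hat : IsAtomicDomain R) (S : SeparatingSystem R) {c y z : R} (hc : c ≠ 0) (hz : z ≠ 0)
    (h : ∀ n : ℕ, z ^ n ∣ c * y ^ n) : z ∣ S.monomial (fun _ => 2 * S.bound) * y := by
  obtain ⟨m, z, hm, hz', rfl⟩ := hat.exists_eq_prod_mul z hz
  clear hz
  induction m using Multiset.induction generalizing y with
  | empty => simpa using S.dvd_monomial_mul_of_isPrimeFree hat hc hz' (by simpa using h)
  | cons s m ih =>
    have hs : Prime s := hm s (Multiset.mem_cons_self s m)
    simp only [Multiset.prod_cons, mul_assoc s] at h ⊢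
    obtain ⟨y, rfl⟩ : s ∣ y := by
      by_contra hsy
      obtain ⟨k, hk⟩ := hat.exists_not_pow_dvd hs c hc
      refine hk (hs.pow_dvd_of_dvd_mul_right k (fun h' => hsy (hs.dvd_of_dvd_pow h'))
        ((pow_dvd_pow_of_dvd (Dvd.intro _ rfl) k).trans (h k)))
    have h' : ∀ n : ℕ, (m.prod * z) ^ n ∣ c * y ^ n := by
      intro n
      have := h n
      rwa [mul_pow s, mul_pow s, mul_left_comm, mul_dvd_mul_iff_left (pow_ne_zero n hs.ne_zero)]
        at this
    rw [mul_left_comm (S.monomial _)]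
    exact mul_dvd_mul_left s (ih (fun t ht => hm t (Multiset.mem_cons_of_mem ht)) h')

/-- The conductor contains a prime-free element. -/
theorem SeparatingSystem.monomial_mem_conductor [Fintype (primeFreePrimes R)]
    (hat : IsAtomicDomain R) (S : SeparatingSystem R) :
    S.monomial (fun _ => 2 * S.bound) ∈ conductor R := by
  rw [mem_conductor_iff]
  rintro q ⟨c, hc, hq⟩
  obtain ⟨y, z, hz, rfl⟩ := IsFractionRing.div_surjective (A := R) q
  have hz0 : z ≠ 0 := nonZeroDivisors.ne_zero hz
  have hz0' : algebraMap R (FractionRing R) z ≠ 0 := by simpa using hz0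
  obtain ⟨w, hw⟩ := S.dvd_monomial_mul hat hc hz0 (y := y) (by
    intro n
    rcases Nat.eq_zero_or_pos n with rfl | hn
    · simp
    · obtain ⟨w, hw⟩ := hq n hn
      refine ⟨w, IsFractionRing.injective R (FractionRing R) ?_⟩
      rw [map_mul, map_mul, map_pow, map_pow, hw, div_pow]
      field_simp)
  refine ⟨w, ?_⟩
  have := congrArg (algebraMap R (FractionRing R)) hw
  rw [map_mul, map_mul] at this
  field_simp
  rw [this, mul_comm]

/-- If `z ^ e` divides `y ^ e`, then `y / z` is almost integral, with common denominator `z ^ e`. -/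
theorem dvd_mul_of_mem_conductor {f y z : R} (hf : f ∈ conductor R) (hz : z ≠ 0) {e : ℕ}
    (he : 0 < e) (h : z ^ e ∣ y ^ e) : z ∣ f * y := by
  have hz0' : algebraMap R (FractionRing R) z ≠ 0 := by simpa using hz
  have hq : algebraMap R (FractionRing R) y / algebraMap R (FractionRing R) z ∈
      completeIntegralClosure R := by
    refine ⟨z ^ e, pow_ne_zero e hz, fun n _ => ?_⟩
    have hd : z ^ n ∣ z ^ e * y ^ n := by
      rw [← Nat.div_add_mod n e, pow_add, pow_add, mul_comm (z ^ e), mul_assoc, pow_mul, pow_mul]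
      exact mul_dvd_mul (pow_dvd_pow_of_dvd h _)
        (dvd_mul_of_dvd_right (pow_dvd_pow z (Nat.mod_lt n he).le) _)
    obtain ⟨w, hw⟩ := hd
    refine ⟨w, ?_⟩
    have := congrArg (algebraMap R (FractionRing R)) hw
    rw [map_mul, map_mul, map_pow, map_pow, map_pow] at this
    rw [div_pow, map_pow, ← mul_div_assoc, this]
    field_simp
  obtain ⟨w, hw⟩ := mem_conductor_iff.1 hf _ hq
  refine ⟨w, IsFractionRing.injective R (FractionRing R) ?_⟩
  rw [map_mul, map_mul, hw]
  field_simp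

/-- A prime `i` without prime elements contains the conductor. Otherwise `i` is locally principal
at `i`, generated by an element `b₀` with least exponent at `i`; a suitable modification
`b₀ + w ^ 2` still generates `i` locally and lies in no other prime without prime elements, so its
prime-free part generates `i` globally and is a prime element. -/
theorem IsGeneralizedCohenKaplansky.conductor_le (hR : IsGeneralizedCohenKaplansky R)
    [Fintype (primeFreePrimes R)] (S : SeparatingSystem R) (i : primeFreePrimes R) :
    conductor R ≤ i.1 := by
  classical
  intro f hf
  by_contra hfi
  have hi := i.2.1
  choose! ex hex using fun h (hh : IsPrimeFree h) => S.exists_pow_associated hh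
  let B : Set R := {h | IsPrimeFree h ∧ h ∈ i.1}
  have hB : B.Nonempty := ⟨S.c i, S.isPrimeFree_c i, (S.c_mem_iff i i).2 rfl⟩
  obtain ⟨b₀, ⟨hb₀, hb₀i⟩, hmin⟩ :=
    (InvImage.wf (fun h => ex h i) (wellFounded_lt (α := ℕ))).has_min B hB
  have hloc₀ : ∀ y ∈ i.1, ∃ t ∉ i.1, b₀ ∣ t * y := by
    intro y hy
    by_cases hy0 : y = 0
    · exact ⟨1, fun h1 => hi.ne_top ((Ideal.eq_top_iff_one _).2 h1), by simp [hy0]⟩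
    obtain ⟨m, y, hm, hyf, rfl⟩ := hR.2.1.exists_eq_prod_mul y hy0
    have hyi : y ∈ i.1 :=
      (hi.mem_or_mem hy).resolve_left (prod_notMem_of_mem_primeFreePrimes i.2 hm)
    have hexle : ex b₀ i ≤ ex y i := not_lt.1 (hmin y ⟨hyf, hyi⟩)
    let δ : primeFreePrimes R → ℕ := Function.update (ex b₀) i 0
    have hdvd : b₀ ^ S.E ∣ (S.monomial δ * y) ^ S.E := by
      have e1 : Associated ((S.monomial δ * y) ^ S.E) (S.monomial (S.E • δ + ex y)) := by
        rw [mul_pow, S.monomial_add, S.monomial_nsmul]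
        exact (hex y hyf).mul_left _
      refine (hex b₀ hb₀).dvd.trans ((S.monomial_dvd_monomial fun j => ?_).trans e1.symm.dvd)
      simp only [Pi.add_apply, Pi.smul_apply, smul_eq_mul]
      by_cases hji : j = i
      · subst hji
        omega
      · have : δ j = ex b₀ j := by simp [δ, hji]
        rw [this]
        exact le_add_right (Nat.le_mul_of_pos_left _ S.E_pos)
    refine ⟨f * S.monomial δ, fun h => ?_, ?_⟩
    · rcases hi.mem_or_mem h with h | h
      · exact hfi h
      · rw [S.monomial_mem_iff] at h
        simp [δ] at h
    · have := dvd_mul_of_mem_conductor hf hb₀.1 S.E_pos hdvd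
      exact this.trans ⟨m.prod, by ring⟩
  let w : R := S.monomial fun j => if j = i ∨ b₀ ∉ j.1 then 1 else 0
  have hw : ∀ j : primeFreePrimes R, w ∈ j.1 ↔ j = i ∨ b₀ ∉ j.1 := by
    intro j
    rw [S.monomial_mem_iff]
    by_cases h : j = i ∨ b₀ ∉ j.1 <;> simp [h]
  have hb₁ : ∀ j : primeFreePrimes R, b₀ + w ^ 2 ∈ j.1 → j = i := by
    intro j hj
    have := j.2.1
    by_contra hji
    by_cases hbj : b₀ ∈ j.1
    · have h2 := this.mem_of_pow_mem 2 ((Ideal.add_mem_iff_right _ hbj).1 hj)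
      exact ((hw j).1 h2).elim hji fun h => h hbj
    · have h2 : w ^ 2 ∈ j.1 := Ideal.pow_mem_of_mem _ ((hw j).2 (.inr hbj)) 2 two_pos
      exact hbj ((Ideal.add_mem_iff_left _ h2).1 hj)
  have hwi : w ∈ i.1 := (hw i).2 (.inl rfl)
  have hb₁i : b₀ + w ^ 2 ∈ i.1 := add_mem hb₀i (Ideal.pow_mem_of_mem _ hwi 2 two_pos)
  have hloc₁ : ∀ y ∈ i.1, ∃ t ∉ i.1, b₀ + w ^ 2 ∣ t * y := by
    intro y hy
    obtain ⟨t, ht, u, hu⟩ := hloc₀ w hwi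
    obtain ⟨t', ht', q, hq⟩ := hloc₀ y hy
    refine ⟨t' * (t + u * w), fun h => ?_, t * q, ?_⟩
    · rcases hi.mem_or_mem h with h | h
      · exact ht' h
      · exact ht ((Ideal.add_mem_iff_left _ (Ideal.mul_mem_left _ u hwi)).1 h)
    · linear_combination (t + u * w) * hq - q * w * hu
  have hb₁0 : b₀ + w ^ 2 ≠ 0 := by
    intro h0
    obtain ⟨t, ht, hd⟩ := hloc₁ b₀ hb₀i
    rw [h0, zero_dvd_iff] at hd
    rcases mul_eq_zero.1 hd with h | h
    · exact ht (h ▸ i.1.zero_mem)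
    · exact hb₀.1 h
  obtain ⟨m, b, hm, hb, hbeq⟩ := hR.2.1.exists_eq_prod_mul _ hb₁0
  have hbi : b ∈ i.1 := by
    rw [hbeq] at hb₁i
    exact (hi.mem_or_mem hb₁i).resolve_left (prod_notMem_of_mem_primeFreePrimes i.2 hm)
  have hspan : i.1 = Ideal.span {b} := by
    refine le_antisymm (fun y hy => ?_) ((Ideal.span_singleton_le_iff_mem _).2 hbi)
    have htop : colonElem (Ideal.span {b}) y = ⊤ := by
      have hbm : b ∈ colonElem (Ideal.span {b}) y :=
        le_colonElem _ y (Ideal.mem_span_singleton_self b)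
      refine (isPrimeSaturated_colonElem hb.isPrimeSaturated_span y).eq_top ?_ ?_
      · intro h0
        rw [h0] at hbm
        exact hb.1 hbm
      · intro p hp hle
        obtain rfl : ⟨p, hp⟩ = i := by
          refine hb₁ ⟨p, hp⟩ ?_
          rw [hbeq]
          exact Ideal.mul_mem_left _ _ (hle hbm)
        obtain ⟨t, ht, hd⟩ := hloc₁ y hy
        refine ht (hle ?_)
        rw [mem_colonElem, Ideal.mem_span_singleton]
        exact (Dvd.intro_left _ hbeq.symm).trans hd
    have h1 : (1 : R) ∈ colonElem (Ideal.span {b}) y := htop ▸ Submodule.mem_top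
    simpa using h1
  refine i.2.2.2 b hbi ((Ideal.span_singleton_prime hb.1).1 ?_)
  rw [← hspan]
  exact hi

/-- The set `P` consists of the ideals generated by prime elements. -/
theorem IsGeneralizedCohenKaplansky.mem_primesNotAboveConductor_iff
    (hR : IsGeneralizedCohenKaplansky R) {p : Ideal R} :
    p ∈ primesNotAboveConductor R ↔ ∃ s, Prime s ∧ p = Ideal.span {s} := by
  have := hR.finite_primeFreePrimes.fintype
  obtain ⟨S⟩ := hR.nonempty_separatingSystem
  constructor
  · rintro ⟨hp, hcp⟩
    exact (hR.mem_minNonzeroPrimes_iff.1 hp).resolve_right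
      fun h => hcp (hR.conductor_le S ⟨p, h⟩)
  · rintro ⟨s, hs, rfl⟩
    refine ⟨hR.mem_minNonzeroPrimes_iff.2 (.inl ⟨s, hs, rfl⟩), fun hle => ?_⟩
    exact (S.isPrimeFree_monomial _).2 s hs
      (Ideal.mem_span_singleton.1 (hle (S.monomial_mem_conductor hR.2.1)))

theorem IsGeneralizedCohenKaplansky.primesAboveConductor_eq
    (hR : IsGeneralizedCohenKaplansky R) : primesAboveConductor R = primeFreePrimes R := by
  ext p
  rw [primesAboveConductor, Set.mem_sdiff, hR.mem_primesNotAboveConductor_iff,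
    hR.mem_minNonzeroPrimes_iff]
  constructor
  · rintro ⟨h1, h2⟩
    exact h1.resolve_left h2
  · intro h
    refine ⟨.inr h, ?_⟩
    rintro ⟨s, hs, rfl⟩
    exact h.2.2 s (Ideal.mem_span_singleton_self s) hs

end Conductor

/-! ### `r`-ideals and prime elements -/

section RIdeals

variable {R : Type*} [CommRing R]

theorem coe_span_singleton_mul (t : R) (V : Ideal R) :
    ((Ideal.span {t} * V : Ideal R) : Set R) = t • (V : Set R) := by
  ext x
  rw [SetLike.mem_coe, Ideal.mem_span_singleton_mul]
  rfl

theorem span_singleton_mul_injective [IsDomain R] {t : R} (ht : t ≠ 0) {V W : Ideal R}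
    (h : Ideal.span {t} * V = Ideal.span {t} * W) : V = W :=
  (Ideal.span_singleton_mul_right_inj ht).1 h

theorem span_singleton_mul_colonElem {I : Ideal R} {s : R} (h : I ≤ Ideal.span {s}) :
    Ideal.span {s} * colonElem I s = I := by
  refine le_antisymm (Ideal.span_singleton_mul_le_iff.2 fun z hz => ?_) fun x hx => ?_
  · rw [mul_comm]
    exact hz
  · obtain ⟨y, rfl⟩ := Ideal.mem_span_singleton.1 (h hx)
    refine Ideal.mem_span_singleton_mul.2 ⟨y, ?_, rfl⟩
    rw [mem_colonElem, mul_comm]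
    exact hx

namespace IdealSystem

variable {r : IdealSystem R}

theorem cl_span_singleton_mul (t : R) (V : Ideal R) :
    r.cl (Ideal.span {t} * V : Ideal R) = Ideal.span {t} * r.cl V := by
  apply SetLike.coe_injective
  rw [coe_span_singleton_mul, coe_span_singleton_mul, r.cl_smul]

theorem IsRIdeal.span_singleton_mul {V : Ideal R} (hV : r.IsRIdeal V) (t : R) :
    r.IsRIdeal (Ideal.span {t} * V) := by
  rw [IsRIdeal, cl_span_singleton_mul, hV]

theorem IsRIdeal.of_span_singleton_mul [IsDomain R] {V : Ideal R} {t : R} (ht : t ≠ 0)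
    (h : r.IsRIdeal (Ideal.span {t} * V)) : r.IsRIdeal V := by
  rw [IsRIdeal, cl_span_singleton_mul] at h
  exact span_singleton_mul_injective ht h

theorem isRIdeal_span_singleton (r : IdealSystem R) (t : R) : r.IsRIdeal (Ideal.span {t}) := by
  have := r.isRIdeal_top.span_singleton_mul t
  rwa [Ideal.mul_top] at this

theorem isRIdeal_colonElem {I : Ideal R} (hI : r.IsRIdeal I) (x : R) :
    r.IsRIdeal (colonElem I x) := by
  refine le_antisymm (fun t ht => ?_) (r.le_cl _)
  have h1 : x * t ∈ (r.cl (x • (colonElem I x : Set R)) : Set R) := by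
    rw [r.cl_smul]
    exact ⟨t, ht, rfl⟩
  have h2 : r.cl (x • (colonElem I x : Set R)) ≤ I := by
    conv_rhs => rw [← (show r.cl I = I from hI)]
    refine r.cl_le_cl ?_
    rintro _ ⟨y, hy, rfl⟩
    show x * y ∈ I
    rw [mul_comm]
    exact hy
  rw [mem_colonElem, mul_comm]
  exact h2 h1

/-- Every proper `r`-ideal that contains a prime element is generated by it. -/
def PrimeElementsMaximal (r : IdealSystem R) : Prop :=
  ∀ J : Ideal R, r.IsRIdeal J → J ≠ ⊤ → ∀ s, Prime s → s ∈ J → J ≤ Ideal.span {s}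

theorem IsFinitary.exists_le_maxSpec (hr : r.IsFinitary) {J : Ideal R} (hJ : r.IsRIdeal J)
    (h0 : J ≠ ⊥) (h1 : J ≠ ⊤) : ∃ M ∈ r.maxSpec, J ≤ M := by
  suffices h : ∃ M, J ≤ M ∧ Maximal (· ∈ {I : Ideal R | r.IsRIdeal I ∧ I ≠ ⊥ ∧ I ≠ ⊤}) M by
    obtain ⟨M, hJM, hM⟩ := h
    exact ⟨M, hM, hJM⟩
  refine zorn_le_nonempty₀ _ (fun C hC hchain I hI => ?_) J ⟨hJ, h0, h1⟩
  have hmem : ∀ x, x ∈ sSup C ↔ ∃ I ∈ C, x ∈ I := fun x =>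
    Submodule.mem_sSup_of_directed ⟨I, hI⟩ hchain.directedOn
  refine ⟨sSup C, ⟨le_antisymm (fun x hx => ?_) (r.le_cl _), ?_, ?_⟩, fun _ h => le_sSup h⟩
  · obtain ⟨E, hE, hEC, hxE⟩ := (hr _ x).1 hx
    obtain ⟨I', hI', hEI'⟩ : ∃ I' ∈ C, E ⊆ (I' : Set R) := by
      clear hxE
      induction E, hE using Set.Finite.induction_on with
      | empty => exact ⟨I, hI, Set.empty_subset _⟩
      | @insert a E _ _ ih =>
        obtain ⟨I₁, h1, h1'⟩ := ih ((Set.subset_insert a E).trans hEC)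
        obtain ⟨I₂, h2, h2'⟩ := (hmem a).1 (hEC (Set.mem_insert a E))
        rcases hchain.total h1 h2 with h | h
        · exact ⟨I₂, h2, Set.insert_subset h2' (h1'.trans h)⟩
        · exact ⟨I₁, h1, Set.insert_subset (h h2') h1'⟩
    have hx' := r.cl_le_cl hEI' hxE
    rw [show r.cl I' = I' from (hC hI').1] at hx'
    exact (hmem x).2 ⟨I', hI', hx'⟩
  · exact ne_bot_of_le_ne_bot (hC hI).2.1 (le_sSup hI)
  · intro htop
    obtain ⟨I', hI', h1'⟩ := (hmem 1).1 (htop ▸ Submodule.mem_top)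
    exact (hC hI').2.2 ((Ideal.eq_top_iff_one _).2 h1')

theorem IsFinitary.primeElementsMaximal (hr : r.IsFinitary)
    (hmax : r.maxSpec = minNonzeroPrimes R) : r.PrimeElementsMaximal := by
  intro J hJ h1 s hs hsJ
  obtain ⟨M, hM, hJM⟩ := hr.exists_le_maxSpec hJ (fun h => hs.ne_zero (by simpa [h] using hsJ)) h1
  rw [hmax] at hM
  exact hJM.trans (hM.2 ⟨(Ideal.span_singleton_prime hs.ne_zero).2 hs, by simpa using hs.ne_zero⟩
    ((Ideal.span_singleton_le_iff_mem _).2 (hJM hsJ)))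

variable [IsDomain R]

theorem primeElementsMaximal_v : (v R).PrimeElementsMaximal := by
  intro J hJ h1 s hs hsJ y hy
  have hJ0 : ¬ (J : Set R) ⊆ {0} := fun h => hs.ne_zero (h hsJ)
  have hJ' : colonIdeal (colon (base R) (algebraMap R (FractionRing R) '' J)) = J := by
    have := hJ
    simpa only [IsRIdeal, v, if_neg hJ0] using this
  -- `J` is proper, so some `z` in the inverse of `J` does not lie in `R`
  obtain ⟨z, hz, hzR⟩ : ∃ z ∈ colon (base R) (algebraMap R (FractionRing R) '' J),
      z ∉ base R := by
    by_contra! hcon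
    refine h1 ((Ideal.eq_top_iff_one J).2 ?_)
    rw [← hJ']
    intro z hz
    simpa using hcon z hz
  obtain ⟨t, ht⟩ := hz _ ⟨s, hsJ, rfl⟩
  obtain ⟨w, hw⟩ := hz _ ⟨y, hy, rfl⟩
  have hinj := IsFractionRing.injective R (FractionRing R)
  have hty : t * y = s * w := hinj (by rw [map_mul, map_mul, ht, hw]; ring)
  rw [Ideal.mem_span_singleton]
  refine (hs.dvd_or_dvd (Dvd.intro w hty.symm)).resolve_left ?_
  rintro ⟨t', rfl⟩
  refine hzR ⟨t', ?_⟩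
  have hs0 : algebraMap R (FractionRing R) s ≠ 0 := by simpa using hs.ne_zero
  rw [map_mul, mul_comm] at ht
  exact mul_right_cancel₀ hs0 ht

/-- A generalized Cohen-Kaplansky G-domain has only finitely many atoms up to associates, so all
its nonzero prime ideals are maximal. -/
theorem primeElementsMaximal_of_isGDomain (hR : IsGeneralizedCohenKaplansky R)
    (hG : IsGDomain R) (r : IdealSystem R) : r.PrimeElementsMaximal := by
  classical
  obtain ⟨-, a, ha, hap⟩ := hG
  obtain ⟨m, h, hm, hh, rfl⟩ := hR.2.1.exists_eq_prod_mul a ha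
  have hfin : {a : Associates R | ∃ b, Associates.mk b = a ∧ Irreducible b}.Finite := by
    refine (hR.2.2.union ((m.toFinset.finite_toSet).image Associates.mk)).subset ?_
    rintro _ ⟨b, rfl, hb⟩
    by_cases hbp : Prime b
    · right
      have hd : b ∣ m.prod * h := Ideal.mem_span_singleton.1
        (hap _ ((Ideal.span_singleton_prime hb.ne_zero).2 hbp) (by simpa using hb.ne_zero))
      obtain ⟨s, hs, hbs⟩ := hbp.exists_mem_multiset_dvd
        ((hbp.dvd_or_dvd hd).resolve_right (hh.2 b hbp))
      exact ⟨s, by simpa using hs, Associates.mk_eq_mk_iff_associated.2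
        (hb.associated_of_dvd (hm s hs).irreducible hbs).symm⟩
    · exact .inl ⟨b, rfl, hb, hbp⟩
  intro J hJ h1 s hs hsJ
  obtain ⟨M, hM, hJM⟩ := Ideal.exists_le_maximal J h1
  have := hM.isPrime
  have hsp := (Ideal.span_singleton_prime hs.ne_zero).2 hs
  rw [hR.2.1.eq_of_le_of_finite_atoms (p := Ideal.span {s}) (q := M) (by simpa using hs.ne_zero)
    ((Ideal.span_singleton_le_iff_mem _).2 (hJM hsJ)) (hfin.subset ?_)]
  · exact hJM
  · rintro _ ⟨b, rfl, hb, -⟩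
    exact ⟨b, rfl, hb⟩

end IdealSystem

/-- An ideal is prime-free if it is contained in no principal ideal generated by a prime
element. -/
def IsPrimeFreeIdeal (I : Ideal R) : Prop := ∀ s, Prime s → ¬ I ≤ Ideal.span {s}

theorem IsPrimeFreeIdeal.mono {I J : Ideal R} (hI : IsPrimeFreeIdeal I) (h : I ≤ J) :
    IsPrimeFreeIdeal J := fun s hs hJ => hI s hs (h.trans hJ)

theorem IsPrimeFreeIdeal.mul {I J : Ideal R} (hI : IsPrimeFreeIdeal I) (hJ : IsPrimeFreeIdeal J) :
    IsPrimeFreeIdeal (I * J) := fun s hs h =>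
  (((Ideal.span_singleton_prime hs.ne_zero).2 hs).mul_le.1 h).elim (hI s hs) (hJ s hs)

/-- For a prime-free `r`-ideal `I` and a prime element `s` with `s * x ∈ I`, the `r`-ideal `(I : x)`
contains `s` but is not contained in `sR`, so it is `R`. -/
theorem IsPrimeFreeIdeal.isPrimeSaturated {r : IdealSystem R} (hr : r.PrimeElementsMaximal)
    {I : Ideal R} (hI : r.IsRIdeal I) (hf : IsPrimeFreeIdeal I) : IsPrimeSaturated I := by
  intro s x hs hx
  by_contra hxI
  have h1 : colonElem I x ≠ ⊤ := fun h => hxI (by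
    simpa using (h ▸ Submodule.mem_top : (1 : R) ∈ colonElem I x))
  exact hf s hs ((le_colonElem I x).trans (hr _ (IdealSystem.isRIdeal_colonElem hI x) h1 s hs hx))

theorem IsPrimeFreeIdeal.dvd_of_span_mul_le [IsDomain R] {I : Ideal R} (hf : IsPrimeFreeIdeal I)
    {m : Multiset R} (hm : ∀ s ∈ m, Prime s) {y : R}
    (h : Ideal.span {y} * I ≤ Ideal.span {m.prod}) : m.prod ∣ y := by
  induction m using Multiset.induction generalizing y with
  | empty => simp
  | cons s m ih =>
    have hs := hm s (Multiset.mem_cons_self s m)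
    rw [Multiset.prod_cons] at h ⊢
    have h1 : Ideal.span {y} * I ≤ Ideal.span {s} :=
      h.trans (Ideal.span_singleton_le_span_singleton.2 (Dvd.intro _ rfl))
    have h2 := (((Ideal.span_singleton_prime hs.ne_zero).2 hs).mul_le.1 h1).resolve_right (hf s hs)
    obtain ⟨y, rfl⟩ := Ideal.span_singleton_le_span_singleton.1 h2
    refine mul_dvd_mul_left s (ih (fun t ht => hm t (Multiset.mem_cons_of_mem ht)) ?_)
    rw [Ideal.span_singleton_mul_le_iff] at h ⊢
    intro z hz
    have := h z hz
    rw [Ideal.mem_span_singleton, mul_assoc, mul_dvd_mul_iff_left hs.ne_zero] at this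
    exact Ideal.mem_span_singleton.2 this

/-- Dividing by prime elements as long as possible writes every nonzero ideal as a product of prime
elements times a prime-free ideal. -/
theorem IsAtomicDomain.exists_eq_span_mul [IsDomain R] (hat : IsAtomicDomain R) {I : Ideal R}
    (h0 : I ≠ ⊥) : ∃ (m : Multiset R) (V : Ideal R), (∀ s ∈ m, Prime s) ∧ IsPrimeFreeIdeal V ∧
      I = Ideal.span {m.prod} * V := by
  obtain ⟨x, hx, hx0⟩ := Submodule.exists_mem_ne_zero_of_ne_bot h0
  obtain ⟨m, h, hm, hh, rfl⟩ := hat.exists_eq_prod_mul x hx0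
  clear h0 hx0
  induction hn : Multiset.card m generalizing m I h with
  | zero =>
    rw [Multiset.card_eq_zero] at hn
    subst hn
    refine ⟨0, I, by simp, fun s hs hle => hh.2 s hs ?_, by simp⟩
    exact Ideal.mem_span_singleton.1 (hle (by simpa using hx))
  | succ n ih =>
    by_cases hI : IsPrimeFreeIdeal I
    · exact ⟨0, I, by simp, hI, by simp⟩
    simp only [IsPrimeFreeIdeal, not_forall, not_not] at hI
    obtain ⟨s, hs, hle⟩ := hI
    have hd := Ideal.mem_span_singleton.1 (hle hx)
    obtain ⟨s', hs', hss⟩ := hs.exists_mem_multiset_dvd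
      ((hs.dvd_or_dvd hd).resolve_right (hh.2 s hs))
    obtain ⟨u, rfl⟩ := hs.irreducible.associated_of_dvd (hm s' hs').irreducible hss
    obtain ⟨m, rfl⟩ := Multiset.exists_cons_of_mem hs'
    have hmem : m.prod * (u * h) ∈ colonElem I s := by
      rw [mem_colonElem]
      convert hx using 1
      rw [Multiset.prod_cons]
      ring
    obtain ⟨m', V, hm', hV, hIV⟩ := ih m (u * h)
      (fun t ht => hm t (Multiset.mem_cons_of_mem ht))
      ((isPrimeFree_of_isUnit u.isUnit).mul hh) hmem (by simpa using hn)
    refine ⟨s ::ₘ m', V, ?_, hV, ?_⟩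
    · simpa [hs] using hm'
    · rw [Multiset.prod_cons, ← Ideal.span_singleton_mul_span_singleton, mul_assoc, ← hIV,
        span_singleton_mul_colonElem hle]

end RIdeals

/-! ### Chains of `r`-ideals -/

section Noetherian

variable {R : Type*} [CommRing R] [IsDomain R]

/-- A prime-saturated ideal is determined by the exponent vectors of the products of nonprime atoms
that it contains, so chains of such ideals are stationary by Dickson's lemma. -/
theorem IsGeneralizedCohenKaplansky.stationary_of_isPrimeSaturated
    (hR : IsGeneralizedCohenKaplansky R) (V : ℕ → Ideal R) (hV : Monotone V)
    (hsat : ∀ n, IsPrimeSaturated (V n)) : ∃ n, ∀ m, n ≤ m → V m = V n := by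
  obtain ⟨A, hA, hA'⟩ := hR.exists_atoms
  let mon : (A → ℕ) → R := fun k => ∏ b : A, (b : R) ^ k b
  have hup : ∀ k l n, k ≤ l → mon k ∈ V n → mon l ∈ V n := fun k l n hkl hk =>
    Ideal.mem_of_dvd _ (Finset.prod_dvd_prod_of_dvd _ _ fun b _ => pow_dvd_pow _ (hkl b)) hk
  suffices h : ∃ n, ∀ m, n ≤ m → ∀ k, mon k ∈ V m → mon k ∈ V n by
    obtain ⟨n, hn⟩ := h
    refine ⟨n, fun m hm => le_antisymm (fun x hx => ?_) (hV hm)⟩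
    by_cases hx0 : x = 0
    · simp [hx0]
    obtain ⟨p, h, hp, hh, rfl⟩ := hR.2.1.exists_eq_prod_mul x hx0
    have hmem : h ∈ unitsClosure (Set.range ((↑) : A → R)) :=
      hR.2.1.isPrimeFree_mem_unitsClosure (by simpa using hA') hh
    obtain ⟨k, hk⟩ := exists_associated_prod_pow hmem
    have h1 : mon k ∈ V m :=
      Ideal.mem_of_dvd _ hk.dvd ((hsat m).mem_of_prod_mul_mem hp hx)
    exact Ideal.mul_mem_left _ _ (Ideal.mem_of_dvd _ hk.symm.dvd (hn m hm k h1))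
  by_contra! hcon
  choose N hN k hk hk' using hcon
  let f : ℕ → ℕ := fun j => N^[j] 0
  have hf : ∀ j, f (j + 1) = N (f j) := fun j => Function.iterate_succ_apply' N j 0
  have hfm : Monotone f := monotone_nat_of_le_succ fun j => hf j ▸ hN (f j)
  obtain ⟨a, b, hab, hle⟩ := wellQuasiOrdered_le (α := A → ℕ) fun j => k (f j)
  refine hk' (f b) (hup _ _ _ hle (hV (hfm (Nat.succ_le_of_lt hab)) ?_))
  rw [Nat.succ_eq_add_one, hf]
  exact hk (f a)

/-- The union of an ascending chain of `r`-ideals need not be an `r`-ideal, but it can be written as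
`tW` with `t` a product of prime elements and `W` prime-free. After division by `t`, the members of
the chain are eventually prime-free, so they are prime-saturated. -/
theorem IdealSystem.PrimeElementsMaximal.isNoetherian (hR : IsGeneralizedCohenKaplansky R)
    {r : IdealSystem R} (hr : r.PrimeElementsMaximal) : r.IsNoetherian := by
  intro I hI hrI
  by_cases hbot : ∀ n, I n = ⊥
  · exact ⟨0, fun m _ => by rw [hbot, hbot]⟩
  push Not at hbot
  obtain ⟨n₀, hn₀⟩ := hbot
  have hU : ∀ x, x ∈ ⨆ n, I n ↔ ∃ n, x ∈ I n := fun x =>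
    Submodule.mem_iSup_of_directed I hI.directed_le
  obtain ⟨p, W, hp, hW, hUW⟩ :=
    hR.2.1.exists_eq_span_mul (ne_bot_of_le_ne_bot hn₀ (le_iSup I n₀))
  let t := p.prod
  have hle : ∀ n, I n ≤ Ideal.span {t} := fun n =>
    (le_iSup I n).trans (hUW ▸ Ideal.mul_le_left)
  let V : ℕ → Ideal R := fun n => colonElem (I n) t
  have hIV : ∀ n, Ideal.span {t} * V n = I n := fun n => span_singleton_mul_colonElem (hle n)
  have hV : Monotone V := fun m n hmn x hx => hI hmn hx
  have hWV : ∀ x ∈ W, ∃ n, x ∈ V n := by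
    intro x hx
    have : x * t ∈ ⨆ n, I n := by
      rw [hUW, mul_comm x]
      exact Ideal.mul_mem_mul (Ideal.mem_span_singleton_self t) hx
    exact (hU _).1 this
  -- from some index on, no prime element divides `V n`
  obtain ⟨N, hN⟩ : ∃ N, IsPrimeFreeIdeal (V N) := by
    have hVn₀ : V n₀ ≠ ⊥ := by
      intro h
      apply hn₀
      rw [← hIV, h, Ideal.mul_bot]
    obtain ⟨x, hx, hx0⟩ := Submodule.exists_mem_ne_zero_of_ne_bot hVn₀
    obtain ⟨m, h, hm, hh, rfl⟩ := hR.2.1.exists_eq_prod_mul x hx0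
    have key : ∀ q : Multiset R, (∀ s ∈ q, Prime s) →
        ∃ N, n₀ ≤ N ∧ ∀ s ∈ q, ¬ V N ≤ Ideal.span {s} := by
      intro q hq
      induction q using Multiset.induction with
      | empty => exact ⟨n₀, le_rfl, by simp⟩
      | cons s q ih =>
        obtain ⟨N, hN, hN'⟩ := ih fun s' hs' => hq s' (Multiset.mem_cons_of_mem hs')
        obtain ⟨y, hyW, hys⟩ := Set.not_subset.1 (hW s (hq s (Multiset.mem_cons_self s q)))
        obtain ⟨n, hyn⟩ := hWV y hyW
        refine ⟨max N n, hN.trans (le_max_left _ _), fun s' hs' hle => ?_⟩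
        rcases Multiset.mem_cons.1 hs' with rfl | hs'
        · exact hys (hle (hV (le_max_right N n) hyn))
        · exact hN' s' hs' ((hV (le_max_left N n)).trans hle)
    obtain ⟨N, hN, hN'⟩ := key m hm
    refine ⟨N, fun s hs hle => ?_⟩
    obtain ⟨s', hs', hss⟩ := hs.exists_mem_multiset_dvd
      ((hs.dvd_or_dvd (Ideal.mem_span_singleton.1 (hle (hV hN hx)))).resolve_right (hh.2 s hs))
    have hass := hs.irreducible.associated_of_dvd (hm s' hs').irreducible hss
    exact hN' s' hs' (hle.trans (Ideal.span_singleton_le_span_singleton.2 hass.symm.dvd))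
  obtain ⟨M, hM⟩ := hR.stationary_of_isPrimeSaturated (fun n => V (N + n))
    (fun m n hmn => hV (Nat.add_le_add_left hmn N)) fun n =>
      (hN.mono (hV (Nat.le_add_right N n))).isPrimeSaturated hr
        (IdealSystem.isRIdeal_colonElem (hrI _) t)
  refine ⟨N + M, fun m hm => ?_⟩
  obtain ⟨d, rfl⟩ := Nat.exists_eq_add_of_le hm
  rw [← hIV, ← hIV (N + M), add_assoc, show V (N + (M + d)) = V (N + M) from hM _ (by omega)]

end Noetherian

/-! ### The prime-free part of the monoid of `r`-ideals -/

theorem IsPrimeSaturated.mem_of_colonElem {R : Type*} [CommRing R] {I : Ideal R}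
    (hI : IsPrimeSaturated I) (h0 : I ≠ ⊥) {x : R}
    (h : ∀ p ∈ primeFreePrimes R, ¬ colonElem I x ≤ p) : x ∈ I := by
  have := (isPrimeSaturated_colonElem hI x).eq_top (ne_bot_of_le_ne_bot h0 (le_colonElem I x)) h
  simpa using (this ▸ Submodule.mem_top : (1 : R) ∈ colonElem I x)

theorem IsPrimeSaturated.exists_isPrimeFree_mem {R : Type*} [CommRing R] [IsDomain R]
    (hat : IsAtomicDomain R) {I : Ideal R} (hI : IsPrimeSaturated I) (h0 : I ≠ ⊥) :
    ∃ h ∈ I, IsPrimeFree h := by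
  obtain ⟨x, hx, hx0⟩ := Submodule.exists_mem_ne_zero_of_ne_bot h0
  obtain ⟨m, h, hm, hh, rfl⟩ := hat.exists_eq_prod_mul x hx0
  exact ⟨h, hI.mem_of_prod_mul_mem hm hx, hh⟩

namespace SeparatingSystem

variable {R : Type*} [CommRing R] [Fintype (primeFreePrimes R)] (S : SeparatingSystem R)

open Classical in
/-- The part of the monomial with exponents `α` that is prime to `i`. -/
noncomputable def coprimePart (i : primeFreePrimes R) (α : primeFreePrimes R → ℕ) : R :=
  S.monomial (Function.update α i 0)

theorem monomial_eq_pow_mul_coprimePart (i : primeFreePrimes R) (α : primeFreePrimes R → ℕ) :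
    S.monomial α = S.c i ^ α i * S.coprimePart i α := by
  classical
  rw [← monomial_single, coprimePart, ← monomial_add]
  congr 1
  ext j
  by_cases hij : j = i
  · subst hij
    simp
  · simp [hij]

theorem coprimePart_notMem (i : primeFreePrimes R) (α : primeFreePrimes R → ℕ) :
    S.coprimePart i α ∉ i.1 := by
  rw [coprimePart, monomial_mem_iff]
  simp

theorem pow_c_mem_iff (i j : primeFreePrimes R) {k : ℕ} (h : S.c i ^ k ∈ j.1) : i = j :=
  (S.c_mem_iff i j).1 (j.2.1.mem_of_pow_mem _ h)

theorem exists_monomial_mem [IsDomain R] (hat : IsAtomicDomain R) {I : Ideal R}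
    (hI : IsPrimeSaturated I) (h0 : I ≠ ⊥) : ∃ α, S.monomial α ∈ I := by
  obtain ⟨h, hhI, hh⟩ := hI.exists_isPrimeFree_mem hat h0
  obtain ⟨α, hα⟩ := S.exists_dvd_monomial hh
  exact ⟨α, Ideal.mem_of_dvd _ hα hhI⟩

/-- A prime-saturated ideal is primary for `i`, in the sense that elements outside `i` can be
cancelled in it, and it contains the bounded power of `c i`. Only finitely many ideals have this
property, see `SeparatingSystem.finite_isBoundedPrimary`. -/
structure IsBoundedPrimary (i : primeFreePrimes R) (I : Ideal R) : Prop where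
  isPrimeSaturated : IsPrimeSaturated I
  mem_of_mul_mem : ∀ x y, y ∉ i.1 → y * x ∈ I → x ∈ I
  pow_bound_mem : S.c i ^ S.bound ∈ I

/-- An ideal that is primary for `i` with bounded exponent is determined by the elements
`c i ^ k * x` in it, where `k ≤ bound` and `x` runs through the finite set of remainders. -/
theorem IsBoundedPrimary.le [IsDomain R] (hat : IsAtomicDomain R) {S : SeparatingSystem R}
    {i : primeFreePrimes R} {I J : Ideal R} (hI : S.IsBoundedPrimary i I)
    (hJ : S.IsBoundedPrimary i J)
    (h : ∀ k ≤ S.bound, ∀ x ∈ S.F, S.c i ^ k * x ∈ I → S.c i ^ k * x ∈ J) : I ≤ J := by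
  intro x hx
  by_cases hx0 : x = 0
  · simp [hx0]
  obtain ⟨m, y, hm, hy, rfl⟩ := hat.exists_eq_prod_mul x hx0
  have hyI := hI.isPrimeSaturated.mem_of_prod_mul_mem hm hx
  obtain ⟨α, z, hz, hα⟩ := S.exists_normalForm y hy
  rw [show (∏ i, S.c i ^ α i) = S.monomial α from rfl,
    S.monomial_eq_pow_mul_coprimePart i, mul_comm (S.c i ^ α i), mul_assoc] at hα
  refine Ideal.mul_mem_left _ _ (Ideal.mem_of_dvd _ hα.symm.dvd (Ideal.mul_mem_left _ _ ?_))
  have hzI := hI.mem_of_mul_mem _ _ (S.coprimePart_notMem i α) (Ideal.mem_of_dvd _ hα.dvd hyI)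
  rcases le_total (α i) S.bound with hle | hle
  · exact h _ hle z hz hzI
  · exact Ideal.mul_mem_right _ _ (Ideal.pow_mem_of_pow_mem J hJ.pow_bound_mem hle)

theorem finite_isBoundedPrimary [IsDomain R] (hat : IsAtomicDomain R) (i : primeFreePrimes R) :
    {I : Ideal R | S.IsBoundedPrimary i I}.Finite := by
  let P : Set R := (fun q : ℕ × R => S.c i ^ q.1 * q.2) '' (Set.Iic S.bound ×ˢ S.F)
  have hP : P.Finite := ((Set.finite_Iic S.bound).prod S.F_finite).image _
  have hle : ∀ I J : Ideal R, S.IsBoundedPrimary i I → S.IsBoundedPrimary i J →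
      P ∩ I = P ∩ J → I ≤ J := by
    intro I J hI hJ hIJ
    refine hI.le hat hJ fun k hk x hx hxI => ?_
    have : S.c i ^ k * x ∈ P ∩ I := ⟨⟨(k, x), ⟨hk, hx⟩, rfl⟩, hxI⟩
    rw [hIJ] at this
    exact this.2
  refine Set.Finite.of_finite_image (f := fun I : Ideal R => P ∩ I)
    (hP.powerset.subset ?_) ?_
  · rintro _ ⟨I, -, rfl⟩
    exact Set.inter_subset_left
  · intro I hI J hJ hIJ
    exact le_antisymm (hle I J hI hJ hIJ) (hle J I hJ hI hIJ.symm)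

end SeparatingSystem

namespace IdealSystem

variable {R : Type*} [CommRing R] {r : IdealSystem R}

theorem IsNoetherian.induction (hN : r.IsNoetherian) {P : r.Ideals → Prop}
    (h : ∀ I : r.Ideals, (∀ J : r.Ideals, I.1 < J.1 → P J) → P I) (I : r.Ideals) : P I := by
  have hwf : WellFoundedGT {I : Ideal R // r.IsRIdeal I} := by
    rw [wellFoundedGT_iff_monotone_chain_condition]
    intro a
    obtain ⟨n, hn⟩ := hN (fun n => (a n).1) a.monotone fun n => (a n).2
    exact ⟨n, fun m hm => Subtype.ext (hn m hm).symm⟩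
  refine (InvImage.wf (fun I : r.Ideals => (⟨I.1, I.2.1⟩ : {I : Ideal R // r.IsRIdeal I}))
    hwf.wf).induction I ?_
  exact fun I ih => h I fun J hJ => ih J hJ

namespace Ideals

theorem cl_val (I : r.Ideals) : r.cl (I.1 : Set R) = I.1 := I.2.1

variable [IsDomain R]

theorem val_mul (I J : r.Ideals) : (I * J).1 = r.cl (I.1 * J.1 : Ideal R) :=
  r.cl_set_mul I.1 J.1

theorem val_one : (1 : r.Ideals).1 = ⊤ := rfl

theorem val_mul_le {I J : r.Ideals} {L : Ideal R} (hL : r.IsRIdeal L) (h : I.1 * J.1 ≤ L) :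
    (I * J).1 ≤ L := by
  rw [val_mul, ← (show r.cl L = L from hL)]
  exact r.cl_le_cl h

theorem val_mul_le_left (I J : r.Ideals) : (I * J).1 ≤ I.1 :=
  val_mul_le I.2.1 Ideal.mul_le_left

theorem val_mul_le_right (I J : r.Ideals) : (I * J).1 ≤ J.1 :=
  val_mul_le J.2.1 Ideal.mul_le_right

theorem mul_val_le (I J : r.Ideals) : I.1 * J.1 ≤ (I * J).1 := by
  rw [val_mul]
  exact r.le_cl _

theorem eq_one_iff {I : r.Ideals} : I = 1 ↔ I.1 = ⊤ := Subtype.ext_iff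

theorem isUnit_iff {I : r.Ideals} : IsUnit I ↔ I = 1 := by
  refine ⟨fun h => ?_, fun h => h ▸ isUnit_one⟩
  obtain ⟨J, hJ⟩ := h.exists_right_inv
  rw [eq_one_iff, eq_top_iff, ← val_one (r := r), ← hJ]
  exact val_mul_le_left I J

/-- The principal ideal generated by a nonzero element, as an `r`-ideal. -/
def principal (r : IdealSystem R) (t : R) (ht : t ≠ 0) : r.Ideals :=
  ⟨Ideal.span {t}, r.isRIdeal_span_singleton t, by simpa using ht⟩

theorem val_principal_mul (t : R) (ht : t ≠ 0) (J : r.Ideals) :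
    (principal r t ht * J).1 = Ideal.span {t} * J.1 := by
  rw [val_mul, principal, cl_span_singleton_mul, cl_val]

/-- The colon ideal `(I : x)`, as an `r`-ideal. -/
def colon (I : r.Ideals) (x : R) : r.Ideals :=
  ⟨colonElem I.1 x, isRIdeal_colonElem I.2.1 x, ne_bot_of_le_ne_bot I.2.2 (le_colonElem _ _)⟩

end Ideals

open Ideals

variable [IsDomain R]

/-- The submonoid of all nonzero `r`-ideals that are divisible by no prime element. -/
def primeFreePart (r : IdealSystem R) : Submonoid r.Ideals where
  carrier := {I | IsPrimeFreeIdeal I.1}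
  one_mem' := fun _ hs h => hs.not_isUnit (Ideal.span_singleton_eq_top.1 (top_le_iff.1 h))
  mul_mem' := fun {I J} hI hJ => IsPrimeFreeIdeal.mono (hI.mul hJ) (mul_val_le I J)

theorem exists_le_of_mem_primeFreePart (hr : r.PrimeElementsMaximal) {I : r.Ideals}
    (hI : I ∈ r.primeFreePart) (h1 : I ≠ 1) : ∃ i : primeFreePrimes R, I.1 ≤ i.1 := by
  by_contra! hcon
  exact h1 (eq_one_iff.2 ((IsPrimeFreeIdeal.isPrimeSaturated hr I.2.1 hI).eq_top I.2.2
    fun p hp => hcon ⟨p, hp⟩))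

/-- If `I * J = I` with `J ≠ R` prime-free, then `J` lies in some prime `i` without prime elements,
a power of which is contained in `c i R`. So `I` is contained in `(c i) ^ k R` for all `k`, which is
impossible. -/
theorem eq_one_of_mul_eq_left (hR : IsGeneralizedCohenKaplansky R)
    [Fintype (primeFreePrimes R)] (S : SeparatingSystem R) (hr : r.PrimeElementsMaximal)
    {I J : r.Ideals} (hJ : J ∈ r.primeFreePart) (h : I * J = I) : J = 1 := by
  by_contra hJ1
  obtain ⟨i, hi⟩ := exists_le_of_mem_primeFreePart hr hJ hJ1
  obtain ⟨n, hn⟩ := Ideal.exists_pow_le_of_le_radical_of_fg (I := i.1) (J := Ideal.span {S.c i})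
    (fun x hx => (S.isPrimeFree_c i).isPrimeSaturated_span.exists_pow_mem
      (by simpa using (S.isPrimeFree_c i).1) fun p hp hle => by
        obtain rfl := (S.c_mem_iff i ⟨p, hp⟩).1 ((Ideal.span_singleton_le_iff_mem _).1 hle)
        exact hx) (hR.fg_of_mem_primeFreePrimes i.2)
  have hpow : ∀ k : ℕ, (J ^ k).1 ≤ r.cl (i.1 ^ k : Ideal R) := by
    intro k
    induction k with
    | zero =>
      rw [pow_zero, pow_zero, Ideal.one_eq_top]
      exact r.le_cl ⊤
    | succ k ih =>
      rw [pow_succ, pow_succ]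
      refine val_mul_le (r.isRIdeal_cl _) ?_
      rw [← r.cl_cl_mul]
      exact (Ideal.mul_mono ih hi).trans (r.le_cl _)
  have hJn : (J ^ n).1 ≤ Ideal.span {S.c i} := by
    refine (hpow n).trans ?_
    rw [← (show r.cl (Ideal.span {S.c i} : Ideal R) = _ from r.isRIdeal_span_singleton _)]
    exact r.cl_le_cl hn
  have hIJ : ∀ k : ℕ, I * J ^ k = I := by
    intro k
    induction k with
    | zero => simp
    | succ k ih => rw [pow_succ, ← mul_assoc, ih, h]
  have hI : ∀ k : ℕ, I.1 ≤ Ideal.span {S.c i ^ k} := by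
    intro k
    induction k with
    | zero => simp
    | succ k ih =>
      rw [← hIJ n, pow_succ, ← Ideal.span_singleton_mul_span_singleton]
      refine val_mul_le ?_ (Ideal.mul_mono ih hJn)
      rw [Ideal.span_singleton_mul_span_singleton]
      exact r.isRIdeal_span_singleton _
  obtain ⟨x, hx, hx0⟩ := Submodule.exists_mem_ne_zero_of_ne_bot I.2.2
  obtain ⟨m, y, hm, hy, rfl⟩ := hR.2.1.exists_eq_prod_mul x hx0
  obtain ⟨α, hα⟩ := S.exists_dvd_monomial hy
  classical
  have hd : S.monomial (Pi.single i (α i + 1)) ∣ S.monomial α := by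
    rw [S.monomial_single]
    refine Dvd.dvd.trans ?_ hα
    exact ((S.isPrimeFree_c i).pow _).dvd_of_dvd_prod_mul hm
      (Ideal.mem_span_singleton.1 (hI _ hx))
  have := S.le_of_monomial_dvd_monomial hd i
  simp at this

/-- A prime-free `r`-ideal `I` contained in `i` is the `r`-product of its components at `i` and away
from `i`, namely the colon ideals by large powers of elements generating the complementary
components. So if `I` is an atom, then it is primary for `i`. -/
theorem exists_pow_mem_of_irreducible (hR : IsGeneralizedCohenKaplansky R)
    [Fintype (primeFreePrimes R)] (S : SeparatingSystem R) (hr : r.PrimeElementsMaximal)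
    {I : r.Ideals} (hI : I ∈ r.primeFreePart) (hirr : Irreducible I) {i : primeFreePrimes R}
    (hi : I.1 ≤ i.1) : ∃ k : ℕ, S.c i ^ k ∈ I.1 := by
  have hsat := IsPrimeFreeIdeal.isPrimeSaturated hr I.2.1 hI
  obtain ⟨α, hα⟩ := S.exists_monomial_mem hR.2.1 hsat I.2.2
  rw [S.monomial_eq_pow_mul_coprimePart i] at hα
  set a := S.c i ^ α i with ha
  set b := S.coprimePart i α with hb
  have hbi : b ∉ i.1 := S.coprimePart_notMem i α
  have haJ : a ∈ (I.colon b).1 := hα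
  have hbJ : b ∈ (I.colon a).1 := by
    show b * a ∈ I.1
    rwa [mul_comm]
  have hIb : I.1 ≤ (I.colon b).1 := le_colonElem _ _
  have hIa : I.1 ≤ (I.colon a).1 := le_colonElem _ _
  have hcop : ∀ Q : Ideal R, a ∈ Q → b ∈ Q → ∀ p ∈ primeFreePrimes R, ¬ Q ≤ p := by
    intro Q haQ hbQ p hp hle
    obtain rfl := S.pow_c_mem_iff i ⟨p, hp⟩ (hle haQ)
    exact hbi (hle hbQ)
  have heq : I = I.colon b * I.colon a := by
    refine Subtype.ext (le_antisymm (fun x hx => ?_) (val_mul_le I.2.1 ?_))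
    · have hf : IsPrimeFreeIdeal (I.colon b * I.colon a).1 :=
        (IsPrimeFreeIdeal.mul hI hI).mono ((Ideal.mul_mono hIb hIa).trans (mul_val_le _ _))
      refine (hf.isPrimeSaturated hr (I.colon b * I.colon a).2.1).mem_of_colonElem
        (I.colon b * I.colon a).2.2 (hcop _ ?_ ?_)
      · exact mul_val_le _ _ (Ideal.mul_mem_mul haJ (hIa hx))
      · rw [mem_colonElem, mul_comm b x]
        exact mul_val_le _ _ (Ideal.mul_mem_mul (hIb hx) hbJ)
    · rw [Ideal.mul_le]
      intro x hx y hy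
      refine hsat.mem_of_colonElem I.2.2 (hcop _ ?_ ?_)
      · rw [mem_colonElem, mul_comm, mul_assoc]
        exact Ideal.mul_mem_left _ _ hy
      · rw [mem_colonElem, mul_comm, mul_right_comm]
        exact Ideal.mul_mem_right _ _ hx
  rcases hirr.isUnit_or_isUnit heq with h | h
  · rw [isUnit_iff, eq_one_iff] at h
    have h1 : (1 : R) ∈ (I.colon b).1 := h ▸ Submodule.mem_top
    have h2 : (1 : R) * b ∈ I.1 := h1
    rw [one_mul] at h2
    exact absurd (hi h2) hbi
  · rw [isUnit_iff, eq_one_iff] at h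
    have h1 : (1 : R) ∈ (I.colon a).1 := h ▸ Submodule.mem_top
    have h2 : (1 : R) * a ∈ I.1 := h1
    rw [one_mul] at h2
    exact ⟨_, h2⟩

theorem radical_mem_of_irreducible (hR : IsGeneralizedCohenKaplansky R)
    [Fintype (primeFreePrimes R)] (S : SeparatingSystem R) (hr : r.PrimeElementsMaximal)
    {I : r.Ideals} (hI : I ∈ r.primeFreePart) (hirr : Irreducible I) :
    I.1.radical ∈ primeFreePrimes R := by
  obtain ⟨i, hi⟩ := exists_le_of_mem_primeFreePart hr hI
    fun h => hirr.not_isUnit (isUnit_iff.2 h)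
  obtain ⟨k, hk⟩ := exists_pow_mem_of_irreducible hR S hr hI hirr hi
  have : I.1.radical = i.1 := by
    refine le_antisymm (i.2.1.radical_le_iff.2 hi) fun x hx => ?_
    refine (IsPrimeFreeIdeal.isPrimeSaturated hr I.2.1 hI).exists_pow_mem I.2.2 fun p hp hle => ?_
    obtain rfl := S.pow_c_mem_iff i ⟨p, hp⟩ (hle hk)
    exact hx
  exact this ▸ i.2

/-- An atom among the prime-free `r`-ideals is either generated by one of the separating elements
or belongs to one of the finitely many ideals that are primary with bounded exponent. -/
theorem finite_irreducible_primeFreePart (hR : IsGeneralizedCohenKaplansky R)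
    [Fintype (primeFreePrimes R)] (S : SeparatingSystem R) (hr : r.PrimeElementsMaximal) :
    {I : r.Ideals | Irreducible I ∧ I ∈ r.primeFreePart}.Finite := by
  have hfin : ((⋃ i : primeFreePrimes R, {I : Ideal R | S.IsBoundedPrimary i I}) ∪
      Set.range fun i => Ideal.span {S.c i}).Finite :=
    (Set.finite_iUnion fun i => S.finite_isBoundedPrimary hR.2.1 i).union (Set.finite_range _)
  refine (hfin.preimage (f := fun I : r.Ideals => I.1) Subtype.val_injective.injOn).subset ?_
  rintro I ⟨hirr, hI⟩
  have hsat := IsPrimeFreeIdeal.isPrimeSaturated hr I.2.1 hI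
  obtain ⟨i, hi⟩ := exists_le_of_mem_primeFreePart hr hI
    fun h => hirr.not_isUnit (isUnit_iff.2 h)
  obtain ⟨k, hk⟩ := exists_pow_mem_of_irreducible hR S hr hI hirr hi
  by_cases hle : I.1 ≤ Ideal.span {S.c i}
  · right
    have heq : I = principal r (S.c i) (S.isPrimeFree_c i).1 * I.colon (S.c i) := by
      apply Subtype.ext
      rw [val_principal_mul]
      exact (span_singleton_mul_colonElem hle).symm
    have hnu : ¬ IsUnit (principal r (S.c i) (S.isPrimeFree_c i).1) := fun h => by
      rw [isUnit_iff, eq_one_iff] at h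
      exact i.2.1.ne_top (top_le_iff.1 (h ▸ (Ideal.span_singleton_le_iff_mem _).2
        ((S.c_mem_iff i i).2 rfl)))
    have h1 := isUnit_iff.1 ((hirr.isUnit_or_isUnit heq).resolve_left hnu)
    rw [h1, mul_one] at heq
    exact ⟨i, congrArg Subtype.val heq.symm⟩
  · left
    have hprim : ∀ x y, y ∉ i.1 → y * x ∈ I.1 → x ∈ I.1 := by
      intro x y hy hyx
      refine hsat.mem_of_colonElem I.2.2 fun p hp hle' => ?_
      obtain rfl := S.pow_c_mem_iff i ⟨p, hp⟩ (hle' (le_colonElem _ _ hk))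
      exact hy (hle' hyx)
    refine Set.mem_iUnion.2 ⟨i, hsat, hprim, ?_⟩
    obtain ⟨x, hx, hxc⟩ := Set.not_subset.1 hle
    have hx0 : x ≠ 0 := by
      rintro rfl
      exact hxc (Submodule.zero_mem _)
    obtain ⟨m, y, hm, hy, rfl⟩ := hR.2.1.exists_eq_prod_mul x hx0
    have hyI := hsat.mem_of_prod_mul_mem hm hx
    obtain ⟨α, z, hz, hα⟩ := S.exists_normalForm y hy
    have hαi : α i = 0 := by
      by_contra h0
      refine hxc (Ideal.mul_mem_left _ _ (Ideal.mem_span_singleton.2 ?_))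
      exact (((dvd_pow_self _ h0).trans (Finset.dvd_prod_of_mem (fun j => S.c j ^ α j)
        (Finset.mem_univ i))).trans (Dvd.intro _ rfl)).trans hα.symm.dvd
    have hmon : S.monomial (α + fun _ => S.bound) ∈ I.1 := by
      refine Ideal.mem_of_dvd _ (hα.dvd.trans ?_) hyI
      rw [S.monomial_add]
      exact mul_dvd_mul_left _ (S.dvd_monomial_of_mem hz)
    rw [S.monomial_eq_pow_mul_coprimePart i, mul_comm, Pi.add_apply, hαi, zero_add] at hmon
    exact hprim _ _ (S.coprimePart_notMem i _) hmon

/-- The semigroup `T` is the monoid of all prime-free `r`-ideals, and the atoms that generate it are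
the prime-free atoms. As `I * J = I` forces `J = 1` for prime-free `J`, proper factors are strictly
larger ideals, so factorization into atoms terminates by the ascending chain condition. -/
theorem conductorPart_eq_primeFreePart (hR : IsGeneralizedCohenKaplansky R)
    [Fintype (primeFreePrimes R)] (S : SeparatingSystem R) (hr : r.PrimeElementsMaximal) :
    r.conductorPart = r.primeFreePart ∧
      r.atomsAboveConductor = {I : r.Ideals | Irreducible I ∧ I ∈ r.primeFreePart} := by
  have hatoms : r.atomsAboveConductor = {I : r.Ideals | Irreducible I ∧ I ∈ r.primeFreePart} := by
    ext I
    rw [atomsAboveConductor, hR.primesAboveConductor_eq]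
    refine and_congr_right fun hirr => ⟨fun h s hs hle => ?_,
      fun h => radical_mem_of_irreducible hR S hr h hirr⟩
    have hsp := hR.2.1.span_mem_minNonzeroPrimes hs
    have := hsp.2 ⟨h.1, h.2.1⟩ (hsp.1.1.radical_le_iff.2 hle)
    exact h.2.2 s ((Ideal.span_singleton_le_iff_mem _).1 this) hs
  refine ⟨le_antisymm ?_ ?_, hatoms⟩
  · rw [conductorPart, hatoms]
    exact Submonoid.closure_le.2 fun I hI => hI.2
  · intro I
    refine (hr.isNoetherian hR).induction (P := fun I => I ∈ r.primeFreePart → I ∈ r.conductorPart)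
      (fun I ih hI => ?_) I
    by_cases hu : IsUnit I
    · rw [isUnit_iff.1 hu]
      exact one_mem _
    by_cases hirr : Irreducible I
    · exact Submonoid.subset_closure (hatoms ▸ ⟨hirr, hI⟩)
    rw [irreducible_iff] at hirr
    push Not at hirr
    obtain ⟨J, L, rfl, hJ, hL⟩ := hirr hu
    have hJf : J ∈ r.primeFreePart := IsPrimeFreeIdeal.mono hI (val_mul_le_left J L)
    have hLf : L ∈ r.primeFreePart := IsPrimeFreeIdeal.mono hI (val_mul_le_right J L)
    refine mul_mem (ih J (lt_of_le_of_ne (val_mul_le_left J L) fun h => hL ?_) hJf)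
      (ih L (lt_of_le_of_ne (val_mul_le_right J L) fun h => hJ ?_) hLf)
    · exact isUnit_iff.2 (eq_one_of_mul_eq_left hR S hr hLf (Subtype.ext h))
    · refine isUnit_iff.2 (eq_one_of_mul_eq_left (I := L) hR S hr hJf ?_)
      rw [mul_comm]
      exact Subtype.ext h

end IdealSystem

/-! ### The decomposition of the monoid of `r`-ideals -/

namespace IdealSystem

open Ideals

theorem exists_associated_prod_map {ι R : Type*} [CommRing R] {g : ι → R}
    (hsurj : ∀ s, Prime s → ∃ i, Associated s (g i))
    {m : Multiset R} (hm : ∀ s ∈ m, Prime s) : ∃ n : Multiset ι,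
      Associated m.prod (n.map g).prod := by
  induction m using Multiset.induction with
  | empty => exact ⟨0, by simp⟩
  | cons s m ih =>
    obtain ⟨n, hn⟩ := ih fun t ht => hm t (Multiset.mem_cons_of_mem ht)
    obtain ⟨i, hi⟩ := hsurj s (hm s (Multiset.mem_cons_self s m))
    refine ⟨i ::ₘ n, ?_⟩
    rw [Multiset.map_cons, Multiset.prod_cons, Multiset.prod_cons]
    exact hi.mul_mul hn

variable {R : Type*} [CommRing R] [IsDomain R] {r : IdealSystem R}

theorem le_of_prod_map_dvd {ι : Type*} {g : ι → R} (hg : ∀ i, Prime (g i))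
    (hinj : ∀ i j, Associated (g i) (g j) → i = j)
    {m n : Multiset ι} (h : (m.map g).prod ∣ (n.map g).prod) : m ≤ n := by
  induction m using Multiset.induction generalizing n with
  | empty => exact Multiset.zero_le n
  | cons i m ih =>
    rw [Multiset.map_cons, Multiset.prod_cons] at h
    obtain ⟨x, hx, hd⟩ := (hg i).exists_mem_multiset_dvd (dvd_of_mul_right_dvd h)
    obtain ⟨j, hj, rfl⟩ := Multiset.mem_map.1 hx
    obtain rfl := hinj i j ((hg i).irreducible.associated_of_dvd (hg j).irreducible hd)
    obtain ⟨n, rfl⟩ := Multiset.exists_cons_of_mem hj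
    rw [Multiset.map_cons, Multiset.prod_cons, mul_dvd_mul_iff_left (hg i).ne_zero] at h
    exact Multiset.cons_le_cons i (ih h)

/-- Every nonzero `r`-ideal is, in a unique way, the product of a product of principal prime ideals
and a prime-free `r`-ideal. -/
theorem nonempty_mulEquiv_prod_primeFreePart (hR : IsGeneralizedCohenKaplansky R) :
    Nonempty (r.Ideals ≃*
      Multiplicative (primesNotAboveConductor R →₀ ℕ) × r.primeFreePart) := by
  classical
  choose g hg hgp using fun p : primesNotAboveConductor R =>
    hR.mem_primesNotAboveConductor_iff.1 p.2
  have hinj : ∀ p q, Associated (g p) (g q) → p = q := fun p q h =>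
    Subtype.ext (by rw [hgp p, hgp q, Ideal.span_singleton_eq_span_singleton.2 h])
  have hsurj : ∀ s, Prime s → ∃ p, Associated s (g p) := fun s hs =>
    let p : primesNotAboveConductor R :=
      ⟨Ideal.span {s}, hR.mem_primesNotAboveConductor_iff.2 ⟨s, hs, rfl⟩⟩
    ⟨p, Ideal.span_singleton_eq_span_singleton.1 (hgp p)⟩
  have hprime : ∀ n : Multiset (primesNotAboveConductor R), ∀ s ∈ n.map g, Prime s := by
    intro n s hs
    obtain ⟨p, -, rfl⟩ := Multiset.mem_map.1 hs
    exact hg p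
  have hne : ∀ n : Multiset (primesNotAboveConductor R), (n.map g).prod ≠ 0 := fun n =>
    Multiset.prod_ne_zero fun h0 => (hprime n 0 h0).ne_zero rfl
  let φ : Multiplicative (primesNotAboveConductor R →₀ ℕ) × r.primeFreePart →ₙ* r.Ideals :=
    { toFun := fun x => principal r _ (hne (Finsupp.toMultiset x.1.toAdd)) * x.2.1
      map_mul' := by
        rintro ⟨f, I⟩ ⟨f', I'⟩
        rw [mul_mul_mul_comm]
        refine congrArg₂ _ (Subtype.ext ?_) rfl
        rw [val_principal_mul]
        simp [principal, Ideal.span_singleton_mul_span_singleton] }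
  have hφ : ∀ x, (φ x).1 =
      Ideal.span {((Finsupp.toMultiset x.1.toAdd).map g).prod} * x.2.1.1 := fun x =>
    val_principal_mul _ _ _
  have hle : ∀ x y, φ x = φ y →
      Finsupp.toMultiset x.1.toAdd ≤ Finsupp.toMultiset y.1.toAdd := by
    intro x y hxy
    refine le_of_prod_map_dvd hg hinj (IsPrimeFreeIdeal.dvd_of_span_mul_le y.2.2 (hprime _) ?_)
    rw [← hφ, ← hxy, hφ]
    exact Ideal.mul_le_left
  refine ⟨(MulEquiv.ofBijective φ ⟨fun x y hxy => ?_, fun I => ?_⟩).symm⟩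
  · have h1 : x.1 = y.1 := Multiplicative.toAdd.injective
      (Multiset.toFinsupp.symm.injective (le_antisymm (hle x y hxy) (hle y x hxy.symm)))
    have h2 := congrArg Subtype.val hxy
    rw [hφ, hφ, h1] at h2
    exact Prod.ext h1 (Subtype.ext (Subtype.ext (span_singleton_mul_injective (hne _) h2)))
  · obtain ⟨m, V, hm, hV, hI⟩ := hR.2.1.exists_eq_span_mul I.2.2
    have hm0 : m.prod ≠ 0 := Multiset.prod_ne_zero fun h0 => (hm 0 h0).ne_zero rfl
    have hrV : r.IsRIdeal V := IsRIdeal.of_span_singleton_mul hm0 (hI ▸ I.2.1)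
    have hV0 : V ≠ ⊥ := by
      rintro rfl
      exact I.2.2 (by rw [hI, Ideal.mul_bot])
    obtain ⟨n, hn⟩ := exists_associated_prod_map hsurj hm
    refine ⟨(Multiplicative.ofAdd (Multiset.toFinsupp n), ⟨⟨V, hrV, hV0⟩, hV⟩), ?_⟩
    apply Subtype.ext
    rw [hφ, hI, Ideal.span_singleton_eq_span_singleton.2 hn]
    simp

end IdealSystem

end RIdealTheory

theorem theorem4p13 {R : Type*} [CommRing R] [IsDomain R]
    (hR : RIdealTheory.IsGeneralizedCohenKaplansky R)
    (r : RIdealTheory.IdealSystem R)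
    (hr : (r.IsFinitary ∧ r.maxSpec = RIdealTheory.minNonzeroPrimes R) ∨
      r = RIdealTheory.IdealSystem.v R ∨
      RIdealTheory.IsGDomain R) :
    r.IsNoetherian ∧
    r.atomsAboveConductor.Finite ∧
    RIdealTheory.IsUnitCancellative r.conductorPart ∧
    r.conductorPart.FG ∧
    Nonempty (r.Ideals ≃*
      Multiplicative (RIdealTheory.primesNotAboveConductor R →₀ ℕ) × r.conductorPart) := by
  have hmax : r.PrimeElementsMaximal := by
    rcases hr with ⟨hfin, hmax⟩ | rfl | hG
    · exact hfin.primeElementsMaximal hmax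
    · exact RIdealTheory.IdealSystem.primeElementsMaximal_v
    · exact RIdealTheory.IdealSystem.primeElementsMaximal_of_isGDomain hR hG r
  have := hR.finite_primeFreePrimes.fintype
  obtain ⟨S⟩ := hR.nonempty_separatingSystem
  obtain ⟨hT, hA⟩ := RIdealTheory.IdealSystem.conductorPart_eq_primeFreePart hR S hmax
  have hfin : r.atomsAboveConductor.Finite :=
    hA ▸ RIdealTheory.IdealSystem.finite_irreducible_primeFreePart hR S hmax
  refine ⟨hmax.isNoetherian hR, hfin, fun a u h => ?_,
    (Submonoid.fg_iff _).2 ⟨_, rfl, hfin⟩, ?_⟩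
  · have hu : u.1 ∈ r.primeFreePart := hT ▸ u.2
    have h1 : u.1 = 1 := RIdealTheory.IdealSystem.eq_one_of_mul_eq_left hR S hmax hu
      (congrArg Subtype.val h)
    rw [show u = 1 from Subtype.ext h1]
    exact isUnit_one
  · rw [hT]
    exact RIdealTheory.IdealSystem.nonempty_mulEquiv_prod_primeFreePart hR
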